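/- All spaces are over $\mathbb C$ and $\otimes$ is the algebraic tensor product. Let $1\le p<\infty$, let $X$ be a separable measure space (its measure has a countable basis) such that $L:=L_p(X)$ is infinite-dimensional, and fix a bilinear operation $\diamond:L\times L\to L$ of norm one. (So $X$ may have a finite non-empty set of atoms, provided it is not reduced to finitely many atoms.) Definitions. Here $L$ stands for any $L_p$-space with a fixed bilinear operation $\diamond$ of norm one. For a linear space $E$ and bounded $a:L\to L'$ put $a\cdot u:=(a\otimes \mathrm{id}_E)u$ for $u\in L\otimes E$. An *$L$-norm* on $E$ is a norm on $L\otimes E$ with $\|a\cdot u\|\le\|a\|\|u\|$ for all bounded operators $a$ on $L$; a *near-$L$-norm* is a norm on $L\otimes E$ for which this is required for $a$ of rank one only. A linear space with such a norm is an *$L$-space* (a *near-$L$-space*). For a linear $\varphi:E\to G$ put $\varphi_\infty:=\mathrm{id}_L\otimes\varphi$; for a bilinear $\rho:E\times F\to G$ let $\rho_\infty:(L\otimes E)\times(L\otimes F)\to L\otimes G$ be the bilinear map with $\rho_\infty(\xi\otimes x,\eta\otimes y)=(\xi\diamond\eta)\otimes\rho(x,y)$. The map $\varphi$ (or $\rho$)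 is *$L$-bounded* if $\varphi_\infty$ (or $\rho_\infty$) is bounded, and *$L$-contractive* if it is contractive. A *proper projection* is an operator $P_Y:f\mapsto f\chi_Y$ with $Y$ measurable. A norm on $L\otimes E$ is *$p$-convex* if $\|u+v\|\le(\|u\|^p+\|v\|^p)^{1/p}$ whenever $P_Y\cdot u=u$, $P_Z\cdot v=v$ and $P_YP_Z=P_ZP_Y=0$. A *$p$-convex tensor product* of near-$L$-spaces $E,F$ is a pair $(\Theta,\theta)$ of a $p$-convex $L$-space $\Theta$ and an $L$-contractive bilinear map $\theta:E\times F\to\Theta$ such that for every $p$-convex $L$-space $G$ and every $L$-bounded bilinear $\rho:E\times F\to G$ there is a unique $L$-bounded linear $R:\Theta\to G$ with $R(\theta(x,y))=\rho(x,y)$ for all $x\in E$, $y\in F$, and moreover $\|R_\infty\|=\|\rho_\infty\|$. Let $\mathbb NX=X_1\sqcup X_2\sqcup\cdots$ be the disjoint union of countably many copies of $X$, $\mathbb L:=L_p(\mathbb NX)$, $J:L\to\mathbb L$, $\xi\mapsto(\xi,0,0,\dots)$, $Q:\mathbb L\to L$, $(\xi_1,\xi_2,\dots)\mapsto\xi_1$,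 and $\xi\,\bar\diamond\,\eta:=J(Q\xi\diamond Q\eta)$ for $\xi,\eta\in\mathbb L$. Given near-$L$-spaces $E,F$, equip $\mathbb L\otimes E$ and $\mathbb L\otimes F$ with the standard extension norms $\|u\|=(\sum_n\|u_n\|^p)^{1/p}$, where $u_n$ is the $n$-th coordinate of $u$, an element of $L\otimes E$, respectively $L\otimes F$. Let $\vartheta:E\times F\to E\otimes F$, $(x,y)\mapsto x\otimes y$. For $U\in\mathbb L\otimes(E\otimes F)$ put $$\|U\|_{p\mathbb L}:=\inf\Big\{\|a\|\Big(\sum_{k=1}^n\|u_k\|^p\|v_k\|^p\Big)^{1/p}:\ U=a\cdot\sum_{k=1}^n I_k\cdot\vartheta_\infty(u_k,v_k)\Big\},$$ where $\vartheta_\infty$ is formed with $\bar\diamond$, $a$ is a bounded operator on $\mathbb L$, $u_k\in\mathbb L\otimes E$, $v_k\in\mathbb L\otimes F$, and the $I_k$ are linear isometries of $\mathbb L$ into itself whose images are images of proper projections and meet pairwise only in $0$. Theorem. For any near-$L$-spaces $E$ and $F$: (i) the standard extension norms are near-$\mathbb L$-norms on $E$ and $F$, $\bar\diamond$ has norm one,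 and $E\otimes F$ with $\|\cdot\|_{p\mathbb L}$ and $\vartheta$ is a $p$-convex tensor product of $E$ and $F$ as near-$\mathbb L$-spaces with respect to $\bar\diamond$; (ii) $E\otimes F$ with the norm $\|U\|_{pL}:=\|(J\otimes\mathrm{id}_{E\otimes F})(U)\|_{p\mathbb L}$ on $L\otimes(E\otimes F)$, together with $\vartheta$, is a $p$-convex tensor product of the near-$L$-spaces $E$ and $F$ with respect to $\diamond$. In particular, any two near-$L_p(X)$-spaces have a $p$-convex tensor product. -/

import Mathlib

open MeasureTheory
open scoped TensorProduct ENNReal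

universe uX uE uF uG uT w

noncomputable section

namespace LSpace

/-! ## Norms, amplifications, (near-)`L`-norms over a general base space -/

section General

/-- `N` is a norm on the complex vector space `V`. -/
structure IsNorm {V : Type*} [AddCommGroup V] [Module ℂ V] (N : V → ℝ) : Prop where
  nonneg : ∀ u, 0 ≤ N u
  add_le : ∀ u v, N (u + v) ≤ N u + N v
  smul : ∀ (c : ℂ) (u : V), N (c • u) = ‖c‖ * N u
  eq_zero : ∀ u, N u = 0 → u = 0

/-- For linear spaces with norms `N`, `M`: the linear map `T` is bounded. -/
def IsBddMap {V W : Type*} [AddCommGroup V] [Module ℂ V] [AddCommGroup W] [Module ℂ W]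
    (N : V → ℝ) (M : W → ℝ) (T : V →ₗ[ℂ] W) : Prop :=
  ∃ C : ℝ, ∀ u, M (T u) ≤ C * N u

/-- The operator norm of a (bounded) linear map with respect to the norms `N`, `M`. -/
def mapNorm {V W : Type*} [AddCommGroup V] [Module ℂ V] [AddCommGroup W] [Module ℂ W]
    (N : V → ℝ) (M : W → ℝ) (T : V →ₗ[ℂ] W) : ℝ :=
  sInf {C : ℝ | 0 ≤ C ∧ ∀ u, M (T u) ≤ C * N u}

/-- The bilinear map `B` is bounded with respect to the norms `N₁`, `N₂`, `M`. -/
def IsBddBilin {V₁ V₂ W : Type*} [AddCommGroup V₁] [Module ℂ V₁] [AddCommGroup V₂] [Module ℂ V₂]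
    [AddCommGroup W] [Module ℂ W]
    (N₁ : V₁ → ℝ) (N₂ : V₂ → ℝ) (M : W → ℝ) (B : V₁ →ₗ[ℂ] V₂ →ₗ[ℂ] W) : Prop :=
  ∃ C : ℝ, ∀ u v, M (B u v) ≤ C * (N₁ u * N₂ v)

/-- The norm of a (bounded) bilinear map with respect to the norms `N₁`, `N₂`, `M`. -/
def bilinNorm {V₁ V₂ W : Type*} [AddCommGroup V₁] [Module ℂ V₁] [AddCommGroup V₂] [Module ℂ V₂]
    [AddCommGroup W] [Module ℂ W]
    (N₁ : V₁ → ℝ) (N₂ : V₂ → ℝ) (M : W → ℝ) (B : V₁ →ₗ[ℂ] V₂ →ₗ[ℂ] W) : ℝ :=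
  sInf {C : ℝ | 0 ≤ C ∧ ∀ u v, M (B u v) ≤ C * (N₁ u * N₂ v)}

variable {L L' : Type*} [NormedAddCommGroup L] [NormedSpace ℂ L]
  [NormedAddCommGroup L'] [NormedSpace ℂ L']

/-- The operator `a ⊗ id_E : L ⊗ E → L' ⊗ E`. For `L' = L` this is the outer multiplication
`u ↦ a · u`, with `a · (ξ ⊗ x) = a ξ ⊗ x`. -/
def act {E : Type*} [AddCommGroup E] [Module ℂ E] (a : L →L[ℂ] L') :
    L ⊗[ℂ] E →ₗ[ℂ] L' ⊗[ℂ] E :=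
  LinearMap.rTensor E (a : L →ₗ[ℂ] L')

/-- `N` is an `L`-norm on `E`: a norm on the amplification `L ⊗ E` with `‖a · u‖ ≤ ‖a‖ ‖u‖` for
every bounded operator `a` on `L`. -/
structure IsLNorm {E : Type*} [AddCommGroup E] [Module ℂ E] (N : L ⊗[ℂ] E → ℝ) : Prop where
  isNorm : IsNorm N
  act_le : ∀ (a : L →L[ℂ] L) (u : L ⊗[ℂ] E), N (act a u) ≤ ‖a‖ * N u

/-- `N` is a near-`L`-norm on `E`: the estimate is required for operators of rank one only. -/
structure IsNearLNorm {E : Type*} [AddCommGroup E] [Module ℂ E] (N : L ⊗[ℂ] E → ℝ) : Prop where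
  isNorm : IsNorm N
  act_le : ∀ (a : L →L[ℂ] L), (a : L →ₗ[ℂ] L).rank = 1 →
    ∀ u : L ⊗[ℂ] E, N (act a u) ≤ ‖a‖ * N u

/-- The amplification `φ_∞ = id_L ⊗ φ : L ⊗ E → L ⊗ F` of a linear map `φ : E → F`. -/
def amp (L : Type*) [NormedAddCommGroup L] [NormedSpace ℂ L]
    {E F : Type*} [AddCommGroup E] [Module ℂ E] [AddCommGroup F] [Module ℂ F]
    (φ : E →ₗ[ℂ] F) : L ⊗[ℂ] E →ₗ[ℂ] L ⊗[ℂ] F :=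
  LinearMap.lTensor L φ

/-- The amplification `ρ_∞ : L ⊗ E × L ⊗ F → L ⊗ G` of a bilinear map `ρ : E × F → G` with respect
to a bilinear operation `dia` on `L`; `ρ_∞ (ξ ⊗ x, η ⊗ y) = dia ξ η ⊗ ρ x y`. -/
def ampBilin (dia : L →L[ℂ] L →L[ℂ] L) {E F G : Type*} [AddCommGroup E] [Module ℂ E]
    [AddCommGroup F] [Module ℂ F] [AddCommGroup G] [Module ℂ G] (ρ : E →ₗ[ℂ] F →ₗ[ℂ] G) :
    L ⊗[ℂ] E →ₗ[ℂ] L ⊗[ℂ] F →ₗ[ℂ] L ⊗[ℂ] G :=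
  TensorProduct.map₂ dia.toLinearMap₁₂ ρ

theorem ampBilin_tmul (dia : L →L[ℂ] L →L[ℂ] L) {E F G : Type*} [AddCommGroup E] [Module ℂ E]
    [AddCommGroup F] [Module ℂ F] [AddCommGroup G] [Module ℂ G] (ρ : E →ₗ[ℂ] F →ₗ[ℂ] G)
    (ξ η : L) (x : E) (y : F) :
    ampBilin dia ρ (ξ ⊗ₜ x) (η ⊗ₜ y) = dia ξ η ⊗ₜ[ℂ] ρ x y := rfl

end General

/-! ## The base space `L_p(X)` and `p`-convexity -/

section Lp

/-- The proper projection `f ↦ f χ_Y` on `L_p(X)`. -/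
def properProj {X : Type uX} [MeasurableSpace X] (p : ℝ≥0∞) [Fact (1 ≤ p)] (μ : Measure X)
    (Y : Set X) (hY : MeasurableSet Y) :
    Lp ℂ p μ →L[ℂ] Lp ℂ p μ :=
  LinearMap.mkContinuous
    { toFun := fun f => ((Lp.memLp f).indicator hY).toLp (Y.indicator f)
      map_add' := by
        intro f g
        rw [← MemLp.toLp_add]
        refine MemLp.toLp_congr _ _ ?_
        filter_upwards [Lp.coeFn_add f g] with x hx
        rw [Pi.add_apply] at hx ⊢
        by_cases h : x ∈ Y
        · rw [Set.indicator_of_mem h, Set.indicator_of_mem h, Set.indicator_of_mem h, hx]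
        · rw [Set.indicator_of_notMem h, Set.indicator_of_notMem h, Set.indicator_of_notMem h,
            add_zero]
      map_smul' := by
        intro c f
        rw [RingHom.id_apply, ← MemLp.toLp_const_smul]
        refine MemLp.toLp_congr _ _ ?_
        filter_upwards [Lp.coeFn_smul c f] with x hx
        rw [Pi.smul_apply] at hx ⊢
        by_cases h : x ∈ Y
        · rw [Set.indicator_of_mem h, Set.indicator_of_mem h, hx]
        · rw [Set.indicator_of_notMem h, Set.indicator_of_notMem h, smul_zero] }
    1 (by
      intro f
      rw [one_mul]
      change ‖((Lp.memLp f).indicator hY).toLp (Y.indicator f)‖ ≤ ‖f‖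
      rw [Lp.norm_toLp, Lp.norm_def]
      exact ENNReal.toReal_mono (Lp.eLpNorm_ne_top f) (eLpNorm_indicator_le _))

variable {X : Type uX} [MeasurableSpace X] {p : ℝ≥0∞} [Fact (1 ≤ p)] {μ : Measure X}

/-- `N` is `p`-convex: `‖u + v‖ ≤ (‖u‖ ^ p + ‖v‖ ^ p) ^ (1 / p)` whenever `u` and `v` have
transversal proper supports. -/
def IsPConvex {E : Type*} [AddCommGroup E] [Module ℂ E] (N : Lp ℂ p μ ⊗[ℂ] E → ℝ) : Prop :=
  ∀ (Y Z : Set X) (hY : MeasurableSet Y) (hZ : MeasurableSet Z),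
    properProj p μ Y hY ∘L properProj p μ Z hZ = 0 →
    properProj p μ Z hZ ∘L properProj p μ Y hY = 0 →
    ∀ u v : Lp ℂ p μ ⊗[ℂ] E,
      act (properProj p μ Y hY) u = u → act (properProj p μ Z hZ) v = v →
      N (u + v) ≤ (N u ^ p.toReal + N v ^ p.toReal) ^ (1 / p.toReal)

/-- `(Θ, θ)`, where `Θ` carries the norm `NΘ` on `L_p(X) ⊗ Θ`, is a (non-completed) `p`-convex
tensor product of `(E, NE)` and `(F, NF)`, with respect to the diamond operation `dia`. -/
structure IsPConvexTensorProduct (dia : Lp ℂ p μ →L[ℂ] Lp ℂ p μ →L[ℂ] Lp ℂ p μ)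
    {E : Type uE} [AddCommGroup E] [Module ℂ E] {F : Type uF} [AddCommGroup F] [Module ℂ F]
    (NE : Lp ℂ p μ ⊗[ℂ] E → ℝ) (NF : Lp ℂ p μ ⊗[ℂ] F → ℝ)
    {Θ : Type uT} [AddCommGroup Θ] [Module ℂ Θ] (NΘ : Lp ℂ p μ ⊗[ℂ] Θ → ℝ)
    (θ : E →ₗ[ℂ] F →ₗ[ℂ] Θ) : Prop where
  isLNorm : IsLNorm NΘ
  isPConvex : IsPConvex NΘ
  contractive : ∀ u v, NΘ (ampBilin dia θ u v) ≤ NE u * NF v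
  universal : ∀ (G : Type w) [AddCommGroup G] [Module ℂ G] (NG : Lp ℂ p μ ⊗[ℂ] G → ℝ),
    IsLNorm NG → IsPConvex NG →
    ∀ ρ : E →ₗ[ℂ] F →ₗ[ℂ] G, IsBddBilin NE NF NG (ampBilin dia ρ) →
      ∃ R : Θ →ₗ[ℂ] G,
        IsBddMap NΘ NG (amp (Lp ℂ p μ) R) ∧
        (∀ x y, R (θ x y) = ρ x y) ∧
        mapNorm NΘ NG (amp (Lp ℂ p μ) R) = bilinNorm NE NF NG (ampBilin dia ρ) ∧
        ∀ R' : Θ →ₗ[ℂ] G, IsBddMap NΘ NG (amp (Lp ℂ p μ) R') →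
          (∀ x y, R' (θ x y) = ρ x y) → R' = R

/-- An isometry on `L_p(X)` is proper if its image is the image of a proper projection. -/
def IsProperIsometry (I : Lp ℂ p μ →ₗᵢ[ℂ] Lp ℂ p μ) : Prop :=
  ∃ (Y : Set X) (hY : MeasurableSet Y), Set.range I = Set.range (properProj p μ Y hY)

/-- The numbers `‖a‖ (∑ ‖u_k‖ ^ p ‖v_k‖ ^ p) ^ (1 / p)`, over all representations
`U = a · ∑ I_k · (u_k ⋄ v_k)` with pairwise disjoint proper isometries `I_k`. -/
def reprValues (dia : Lp ℂ p μ →L[ℂ] Lp ℂ p μ →L[ℂ] Lp ℂ p μ)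
    {E : Type*} [AddCommGroup E] [Module ℂ E] {F : Type*} [AddCommGroup F] [Module ℂ F]
    (NE : Lp ℂ p μ ⊗[ℂ] E → ℝ) (NF : Lp ℂ p μ ⊗[ℂ] F → ℝ)
    (U : Lp ℂ p μ ⊗[ℂ] (E ⊗[ℂ] F)) : Set ℝ :=
  {r | ∃ (n : ℕ) (a : Lp ℂ p μ →L[ℂ] Lp ℂ p μ) (I : Fin n → Lp ℂ p μ →ₗᵢ[ℂ] Lp ℂ p μ)
      (u : Fin n → Lp ℂ p μ ⊗[ℂ] E) (v : Fin n → Lp ℂ p μ ⊗[ℂ] F),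
      (∀ k, IsProperIsometry (I k)) ∧
      (∀ j k, j ≠ k → Set.range (I j) ∩ Set.range (I k) = {0}) ∧
      U = act a (∑ k, act (I k).toContinuousLinearMap
        (ampBilin dia (TensorProduct.mk ℂ E F) (u k) (v k))) ∧
      r = ‖a‖ * (∑ k, NE (u k) ^ p.toReal * NF (v k) ^ p.toReal) ^ (1 / p.toReal)}

/-- The `p`-convex tensor norm `‖U‖_{pL}` on `L_p(X) ⊗ (E ⊗ F)`. -/
def pTensorNorm (dia : Lp ℂ p μ →L[ℂ] Lp ℂ p μ →L[ℂ] Lp ℂ p μ)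
    {E : Type*} [AddCommGroup E] [Module ℂ E] {F : Type*} [AddCommGroup F] [Module ℂ F]
    (NE : Lp ℂ p μ ⊗[ℂ] E → ℝ) (NF : Lp ℂ p μ ⊗[ℂ] F → ℝ)
    (U : Lp ℂ p μ ⊗[ℂ] (E ⊗[ℂ] F)) : ℝ :=
  sInf (reprValues dia NE NF U)

end Lp

/-! ## The measure space `ℕX` and the passage from `L_p(X)` to `L_p(ℕX)` -/

section Copies

variable {X : Type uX} [MeasurableSpace X]

/-- The disjoint union `ℕX` of countably many copies of the measure space `X`, realized on
`ℕ × X`; the copies are the sets `{n} × X`. -/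
def copies (μ : Measure X) : Measure (ℕ × X) :=
  Measure.sum fun n : ℕ => μ.map (Prod.mk n)

theorem copies_restrict (μ : Measure X) (n : ℕ) :
    (copies μ).restrict ({n} ×ˢ Set.univ) = μ.map (Prod.mk n) := by
  ext s hs
  have hn : MeasurableSet (({n} : Set ℕ) ×ˢ (Set.univ : Set X)) :=
    (measurableSet_singleton n).prod MeasurableSet.univ
  rw [Measure.restrict_apply hs, copies, Measure.sum_apply _ (hs.inter hn), tsum_eq_single n]
  · rw [Measure.map_apply measurable_prodMk_left (hs.inter hn),
      Measure.map_apply measurable_prodMk_left hs]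
    congr 1
    ext x
    simp
  · intro m hm
    rw [Measure.map_apply measurable_prodMk_left (hs.inter hn)]
    convert measure_empty (μ := μ)
    ext x
    simp [hm]

theorem map_le_copies (μ : Measure X) (n : ℕ) : μ.map (Prod.mk n) ≤ copies μ := by
  rw [← copies_restrict]
  exact Measure.restrict_le_self

theorem quasi_copies (μ : Measure X) (n : ℕ) :
    Measure.QuasiMeasurePreserving (Prod.mk n) μ (copies μ) :=
  ⟨measurable_prodMk_left, (map_le_copies μ n).absolutelyContinuous⟩

theorem eLpNorm_comp_le (p : ℝ≥0∞) {μ : Measure X} (n : ℕ) {g : ℕ × X → ℂ}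
    (hg : AEStronglyMeasurable g (copies μ)) :
    eLpNorm (fun x => g (n, x)) p μ ≤ eLpNorm g p (copies μ) := by
  have h := eLpNorm_map_measure (p := p) (μ := μ) (f := Prod.mk n) (g := g)
    (hg.mono_measure (map_le_copies μ n)) measurable_prodMk_left.aemeasurable
  calc eLpNorm (fun x => g (n, x)) p μ = eLpNorm g p (μ.map (Prod.mk n)) := h.symm
    _ ≤ _ := eLpNorm_mono_measure _ (map_le_copies μ n)

theorem memLp_comp {p : ℝ≥0∞} {μ : Measure X} (n : ℕ) {g : ℕ × X → ℂ}
    (hg : MemLp g p (copies μ)) : MemLp (fun x => g (n, x)) p μ :=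
  ⟨hg.1.comp_quasiMeasurePreserving (quasi_copies μ n),
    (eLpNorm_comp_le p n hg.1).trans_lt hg.2⟩

/-- The function on `ℕ × X` that is `f` on the copy with index `0` and zero on the other copies. -/
def extendZero {X : Type uX} (f : X → ℂ) : ℕ × X → ℂ :=
  fun z => if z.1 = 0 then f z.2 else 0

theorem extendZero_eq {X : Type uX} (f : X → ℂ) :
    extendZero f = (({0} : Set ℕ) ×ˢ (Set.univ : Set X)).indicator (fun z => f z.2) := by
  ext z
  by_cases hz : z.1 = 0 <;> simp [extendZero, Set.indicator, hz]

theorem eLpNorm_extendZero (p : ℝ≥0∞) {μ : Measure X} {f : X → ℂ} (hf : StronglyMeasurable f) :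
    eLpNorm (extendZero f) p (copies μ) = eLpNorm f p μ := by
  rw [extendZero_eq, eLpNorm_indicator_eq_eLpNorm_restrict
    ((measurableSet_singleton 0).prod MeasurableSet.univ), copies_restrict,
    eLpNorm_map_measure (g := fun z : ℕ × X => f z.2)
      (hf.comp_measurable measurable_snd).aestronglyMeasurable
      measurable_prodMk_left.aemeasurable]
  rfl

theorem memLp_extendZero {p : ℝ≥0∞} [Fact (1 ≤ p)] {μ : Measure X} (f : Lp ℂ p μ) :
    MemLp (extendZero f) p (copies μ) := by
  have hf := Lp.stronglyMeasurable f
  refine ⟨?_, ?_⟩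
  · rw [extendZero_eq]
    exact ((hf.comp_measurable measurable_snd).indicator
      ((measurableSet_singleton 0).prod MeasurableSet.univ)).aestronglyMeasurable
  · rw [eLpNorm_extendZero p hf]
    exact Lp.eLpNorm_lt_top f

theorem ae_copies {μ : Measure X} {q : X → Prop} (h : ∀ᵐ x ∂μ, q x) :
    ∀ᵐ z ∂(copies μ), q z.2 := by
  have hq : Measure.QuasiMeasurePreserving (Prod.snd : ℕ × X → X) (copies μ) μ := by
    refine ⟨measurable_snd, Measure.AbsolutelyContinuous.mk fun s hs h0 => ?_⟩
    rw [Measure.map_apply measurable_snd hs, copies, Measure.sum_apply _ (measurable_snd hs)]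
    refine ENNReal.tsum_eq_zero.2 fun n => ?_
    rw [Measure.map_apply measurable_prodMk_left (measurable_snd hs)]
    exact h0
  exact hq.ae h

/-- The `n`-th coordinate `L_p(ℕX) → L_p(X)`, the restriction of a function to the `n`-th copy. -/
def component (p : ℝ≥0∞) [Fact (1 ≤ p)] (μ : Measure X) (n : ℕ) :
    Lp ℂ p (copies μ) →L[ℂ] Lp ℂ p μ :=
  LinearMap.mkContinuous
    { toFun := fun g => (memLp_comp n (Lp.memLp g)).toLp (fun x => g (n, x))
      map_add' := by
        intro f g
        rw [← MemLp.toLp_add]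
        exact MemLp.toLp_congr _ _ ((quasi_copies μ n).ae (Lp.coeFn_add f g))
      map_smul' := by
        intro c g
        rw [RingHom.id_apply, ← MemLp.toLp_const_smul]
        exact MemLp.toLp_congr _ _ ((quasi_copies μ n).ae (Lp.coeFn_smul c g)) }
    1 (by
      intro g
      rw [one_mul]
      change ‖(memLp_comp n (Lp.memLp g)).toLp (fun x => g (n, x))‖ ≤ ‖g‖
      rw [Lp.norm_toLp, Lp.norm_def]
      exact ENNReal.toReal_mono (Lp.eLpNorm_ne_top g)
        (eLpNorm_comp_le p n (Lp.memLp g).1))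

/-- The isometry `J : L_p(X) → L_p(ℕX)`, `ξ ↦ (ξ, 0, 0, …)`. -/
def J (p : ℝ≥0∞) [Fact (1 ≤ p)] (μ : Measure X) : Lp ℂ p μ →L[ℂ] Lp ℂ p (copies μ) :=
  LinearMap.mkContinuous
    { toFun := fun f => (memLp_extendZero f).toLp (extendZero f)
      map_add' := by
        intro f g
        rw [← MemLp.toLp_add]
        refine MemLp.toLp_congr _ _ ?_
        filter_upwards [ae_copies (Lp.coeFn_add f g)] with z hz
        rw [Pi.add_apply] at hz ⊢
        by_cases h : z.1 = 0
        · simp only [extendZero, if_pos h, hz]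
        · simp only [extendZero, if_neg h, add_zero]
      map_smul' := by
        intro c f
        rw [RingHom.id_apply, ← MemLp.toLp_const_smul]
        refine MemLp.toLp_congr _ _ ?_
        filter_upwards [ae_copies (Lp.coeFn_smul c f)] with z hz
        rw [Pi.smul_apply] at hz ⊢
        by_cases h : z.1 = 0
        · simp only [extendZero, if_pos h, hz]
        · simp only [extendZero, if_neg h, smul_zero] }
    1 (by
      intro f
      rw [one_mul]
      change ‖(memLp_extendZero f).toLp (extendZero f)‖ ≤ ‖f‖
      rw [Lp.norm_toLp, Lp.norm_def, eLpNorm_extendZero p (Lp.stronglyMeasurable f)])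

/-- The coisometry `Q : L_p(ℕX) → L_p(X)`, `(ξ₁, ξ₂, …) ↦ ξ₁`. -/
def Q (p : ℝ≥0∞) [Fact (1 ≤ p)] (μ : Measure X) : Lp ℂ p (copies μ) →L[ℂ] Lp ℂ p μ :=
  component p μ 0

variable {p : ℝ≥0∞} [Fact (1 ≤ p)] {μ : Measure X}

/-- The diamond operation on `L_p(ℕX)` given by `(ξ, η) ↦ J (Q ξ ⋄ Q η)`. -/
def diaBar (dia : Lp ℂ p μ →L[ℂ] Lp ℂ p μ →L[ℂ] Lp ℂ p μ) :
    Lp ℂ p (copies μ) →L[ℂ] Lp ℂ p (copies μ) →L[ℂ] Lp ℂ p (copies μ) :=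
  (ContinuousLinearMap.compL ℂ (Lp ℂ p (copies μ)) (Lp ℂ p μ) (Lp ℂ p (copies μ)) (J p μ)).comp
    (dia.bilinearComp (Q p μ) (Q p μ))

theorem diaBar_apply (dia : Lp ℂ p μ →L[ℂ] Lp ℂ p μ →L[ℂ] Lp ℂ p μ)
    (ξ η : Lp ℂ p (copies μ)) :
    diaBar dia ξ η = J p μ (dia (Q p μ ξ) (Q p μ η)) := rfl

/-- The standard extension of a norm `N` on `L_p(X) ⊗ E` to `L_p(ℕX) ⊗ E`:
`‖u‖ = (∑ₙ ‖uₙ‖ ^ p) ^ (1 / p)`, with `uₙ` the coordinates of `u`. The series converges for every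
`u` if `N` is a near-`L_p(X)`-norm. -/
def stdExt {E : Type*} [AddCommGroup E] [Module ℂ E] (N : Lp ℂ p μ ⊗[ℂ] E → ℝ)
    (u : Lp ℂ p (copies μ) ⊗[ℂ] E) : ℝ :=
  (∑' n : ℕ, N (act (component p μ n) u) ^ p.toReal) ^ (1 / p.toReal)

/-- The norm on `L_p(X) ⊗ (E ⊗ F)` obtained by pulling back along `J ⊗ id` the `p`-convex tensor
norm over `L_p(ℕX)` that belongs to the standard extensions of `NE` and `NF` and to the
operation `diaBar dia`. -/
def pulledBackNorm (dia : Lp ℂ p μ →L[ℂ] Lp ℂ p μ →L[ℂ] Lp ℂ p μ)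
    {E : Type*} [AddCommGroup E] [Module ℂ E] {F : Type*} [AddCommGroup F] [Module ℂ F]
    (NE : Lp ℂ p μ ⊗[ℂ] E → ℝ) (NF : Lp ℂ p μ ⊗[ℂ] F → ℝ)
    (U : Lp ℂ p μ ⊗[ℂ] (E ⊗[ℂ] F)) : ℝ :=
  pTensorNorm (diaBar dia) (stdExt NE) (stdExt NF) (act (J p μ) U)

end Copies

end LSpace

end

/-!
The `p`-convex tensor product of near-`L_p(X)`-spaces is `E ⊗ F` with an explicit norm, and the
proof rests on two estimates against an arbitrary `p`-convex `L`-space `G` and a bilinear map `ρ`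
from `E × F` to `G` whose amplification has bound `C`.

Over `𝕃 = L_p(ℕX)` a representation `U = a · ∑ I_k · (u_k ⋄ v_k)` is sent by the linearization of
`ρ` to `a · ∑ I_k · ρ_∞(u_k, v_k)`. The ranges of the `I_k` are pairwise disjoint bands, so
`p`-convexity of `G` bounds this by `C ‖a‖ (∑ ‖u_k‖ ^ p ‖v_k‖ ^ p) ^ (1 / p)`
(`norm_amp_lift_le_of_mem_reprValues`). This is the universal property, and for `G = ℂ`, with `ρ`
ranging over products of bounded functionals, it shows that the tensor norm is definite. The
triangle inequality and `p`-convexity come from merging two representations: one is moved to the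
even copies of `X` and the other to the odd ones, and the outer factors `a`, `b` are combined into
`a T₀ + b T₁` with `T₀`, `T₁` left inverses of the two shifts (`exists_merge`). The isometries
used are induced by injections of `ℕ`, so they map bands to bands. A representation is rescaled
beforehand so that Hölder's inequality (`pTensorNorm_add_le`), or the disjointness of the two
bands (`isPConvex_pTensorNorm`), gives the constant `1`.

Over `L = L_p(X)` this merging is not available, as `L` need not be isometric to the `ℓ_p`-sum of
two copies of itself, for instance if `X` has a finite positive number of atoms. A representation
of `J · U` amounts to `U = ∑ b_k · (u_k ⋄ v_k)`, where `(b_1, …, b_n)` is an operator of norm at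
most `‖a‖` from the `ℓ_p`-sum of `n` copies of `L` to `L`. The required inequality `‖∑ b_k · z_k‖
≤ ‖a‖ (∑ ‖z_k‖ ^ p) ^ (1 / p)` in `G` (`IsPConvex.norm_sum_act_le`) is stable under approximation
of the `z_k`, so it is enough to consider `z_k` with first factors in the span of finitely many
disjointly supported unit vectors `e_i`. That span is isometric to a finite-dimensional `ℓ_p` and
is the range of a norm one projection, and since `L` is infinite-dimensional it contains as many
disjointly supported unit vectors `e_{k,i}` as are needed. The operators between the spans of
`(e_i)` and `(e_{k,i})_i` then play the role of isometries of `L` onto disjoint copies. No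
classification of measure spaces enters.
-/

namespace LSpace

/-! ### Bands and disjointly supported functions in `L_p` -/

section Bands

variable {X : Type*} [MeasurableSpace X] {p : ℝ≥0∞} [Fact (1 ≤ p)] {μ : Measure X}

theorem one_le_toReal (hp : p ≠ ∞) : 1 ≤ p.toReal :=
  (ENNReal.dichotomy p).resolve_left hp

theorem toReal_pos' (hp : p ≠ ∞) : 0 < p.toReal :=
  zero_lt_one.trans_le (one_le_toReal hp)

theorem properProj_apply {Y : Set X} (hY : MeasurableSet Y) (f : Lp ℂ p μ) :
    properProj p μ Y hY f = ((Lp.memLp f).indicator hY).toLp (Y.indicator f) :=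
  rfl

theorem coeFn_properProj {Y : Set X} (hY : MeasurableSet Y) (f : Lp ℂ p μ) :
    properProj p μ Y hY f =ᵐ[μ] Y.indicator f := by
  rw [properProj_apply]
  exact MemLp.coeFn_toLp _

theorem properProj_eq_self_iff {Y : Set X} (hY : MeasurableSet Y) (f : Lp ℂ p μ) :
    properProj p μ Y hY f = f ↔ ∀ᵐ x ∂μ, x ∉ Y → f x = 0 := by
  rw [Lp.ext_iff]
  constructor
  · intro h
    filter_upwards [h, coeFn_properProj hY f] with x h1 h2 hx
    rw [← h1, h2, Set.indicator_of_notMem hx]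
  · intro h
    filter_upwards [h, coeFn_properProj hY f] with x h1 h2
    rw [h2]
    by_cases hx : x ∈ Y
    · rw [Set.indicator_of_mem hx]
    · rw [Set.indicator_of_notMem hx, h1 hx]

theorem properProj_comp {Y Z : Set X} (hY : MeasurableSet Y) (hZ : MeasurableSet Z)
    (f : Lp ℂ p μ) :
    properProj p μ Y hY (properProj p μ Z hZ f) = properProj p μ (Y ∩ Z) (hY.inter hZ) f := by
  rw [Lp.ext_iff]
  filter_upwards [coeFn_properProj hY (properProj p μ Z hZ f), coeFn_properProj hZ f,
    coeFn_properProj (hY.inter hZ) f] with x h1 h2 h3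
  rw [h1, h3, ← Set.indicator_indicator]
  by_cases hx : x ∈ Y
  · rw [Set.indicator_of_mem hx, Set.indicator_of_mem hx, h2]
  · rw [Set.indicator_of_notMem hx, Set.indicator_of_notMem hx]

theorem properProj_comm {Y Z : Set X} (hY : MeasurableSet Y) (hZ : MeasurableSet Z)
    (f : Lp ℂ p μ) :
    properProj p μ Y hY (properProj p μ Z hZ f) = properProj p μ Z hZ (properProj p μ Y hY f) := by
  rw [properProj_comp, properProj_comp]
  congr 1
  simp only [Set.inter_comm]

theorem properProj_idem {Y : Set X} (hY : MeasurableSet Y) (f : Lp ℂ p μ) :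
    properProj p μ Y hY (properProj p μ Y hY f) = properProj p μ Y hY f := by
  rw [properProj_comp]
  congr 1
  simp only [Set.inter_self]

theorem mem_range_properProj_iff {Y : Set X} (hY : MeasurableSet Y) (f : Lp ℂ p μ) :
    f ∈ Set.range (properProj p μ Y hY) ↔ properProj p μ Y hY f = f :=
  ⟨by rintro ⟨g, rfl⟩; exact properProj_idem hY g, fun h => ⟨f, h⟩⟩

theorem properProj_eq_zero_of_disjoint {Y Z : Set X} (hY : MeasurableSet Y) (hZ : MeasurableSet Z)
    (h : Disjoint Y Z) (f : Lp ℂ p μ) : properProj p μ Y hY (properProj p μ Z hZ f) = 0 := by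
  rw [properProj_comp, Lp.eq_zero_iff_ae_eq_zero]
  filter_upwards [coeFn_properProj (hY.inter hZ) f] with x h1
  rw [h1]
  simp [h.inter_eq]

theorem properProj_empty (f : Lp ℂ p μ) : properProj p μ ∅ MeasurableSet.empty f = 0 := by
  rw [Lp.eq_zero_iff_ae_eq_zero]
  filter_upwards [coeFn_properProj MeasurableSet.empty f] with x h1
  rw [h1]
  simp

theorem properProj_univ (f : Lp ℂ p μ) : properProj p μ Set.univ MeasurableSet.univ f = f := by
  rw [properProj_eq_self_iff]
  simp

theorem properProj_union {Y Z : Set X} (hY : MeasurableSet Y) (hZ : MeasurableSet Z)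
    (f : Lp ℂ p μ) :
    properProj p μ (Y ∪ Z) (hY.union hZ) f =
      properProj p μ Y hY f + properProj p μ Z hZ f
        - properProj p μ Y hY (properProj p μ Z hZ f) := by
  rw [properProj_comp, Lp.ext_iff]
  filter_upwards [coeFn_properProj hY f, coeFn_properProj hZ f, coeFn_properProj (hY.inter hZ) f,
    coeFn_properProj (hY.union hZ) f,
    Lp.coeFn_sub (properProj p μ Y hY f + properProj p μ Z hZ f)
      (properProj p μ (Y ∩ Z) (hY.inter hZ) f),
    Lp.coeFn_add (properProj p μ Y hY f) (properProj p μ Z hZ f)] with x h1 h2 h3 h4 h5 h6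
  rw [h4, h5, Pi.sub_apply, h6, Pi.add_apply, h1, h2, h3]
  by_cases hx : x ∈ Y <;> by_cases hx' : x ∈ Z <;> simp [hx, hx']

theorem ofReal_norm_rpow (hp : p ≠ ∞) (f : Lp ℂ p μ) :
    ENNReal.ofReal (‖f‖ ^ p.toReal) = ∫⁻ x, ‖f x‖ₑ ^ p.toReal ∂μ := by
  have h0 : p ≠ 0 := (zero_lt_one.trans_le (Fact.out : 1 ≤ p)).ne'
  rw [← ENNReal.ofReal_rpow_of_nonneg (norm_nonneg _) (toReal_pos' hp).le, Lp.norm_def,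
    ENNReal.ofReal_toReal (Lp.eLpNorm_ne_top f), eLpNorm_eq_lintegral_rpow_enorm_toReal h0 hp,
    ← ENNReal.rpow_mul, one_div, inv_mul_cancel₀ (toReal_pos' hp).ne', ENNReal.rpow_one]

theorem ofReal_norm_properProj_rpow (hp : p ≠ ∞) {Y : Set X} (hY : MeasurableSet Y)
    (f : Lp ℂ p μ) :
    ENNReal.ofReal (‖properProj p μ Y hY f‖ ^ p.toReal) = ∫⁻ x in Y, ‖f x‖ₑ ^ p.toReal ∂μ := by
  rw [ofReal_norm_rpow hp, ← lintegral_indicator hY]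
  refine lintegral_congr_ae ?_
  filter_upwards [coeFn_properProj hY f] with x hx
  rw [hx]
  by_cases h : x ∈ Y
  · simp [h]
  · simp [h, toReal_pos' hp]

theorem sum_norm_properProj_rpow_le (hp : p ≠ ∞) {ι : Type*} (s : Finset ι) (Y : ι → Set X)
    (hY : ∀ i, MeasurableSet (Y i)) (hd : Pairwise fun i j => Disjoint (Y i) (Y j))
    (f : Lp ℂ p μ) :
    ∑ i ∈ s, ‖properProj p μ (Y i) (hY i) f‖ ^ p.toReal ≤ ‖f‖ ^ p.toReal := by
  have h0 : ∀ i ∈ s, 0 ≤ ‖properProj p μ (Y i) (hY i) f‖ ^ p.toReal :=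
    fun i _ => Real.rpow_nonneg (norm_nonneg _) _
  rw [← ENNReal.ofReal_le_ofReal_iff (Real.rpow_nonneg (norm_nonneg _) _),
    ENNReal.ofReal_sum_of_nonneg h0, ofReal_norm_rpow hp]
  simp_rw [ofReal_norm_properProj_rpow hp]
  rw [← lintegral_biUnion_finset (fun i _ j _ hij => hd hij) (fun i _ => hY i)]
  exact setLIntegral_le_lintegral _ _

/-- Two elements of `L_p` are disjoint if almost everywhere one of them vanishes. -/
def DisjointSupp (f g : Lp ℂ p μ) : Prop := ∀ᵐ x ∂μ, f x = 0 ∨ g x = 0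

omit [Fact (1 ≤ p)] in
theorem DisjointSupp.add_right {f g h : Lp ℂ p μ} (hg : DisjointSupp f g)
    (hh : DisjointSupp f h) : DisjointSupp f (g + h) := by
  filter_upwards [hg, hh, Lp.coeFn_add g h] with x h1 h2 h3
  rw [h3, Pi.add_apply]
  rcases h1 with h1 | h1
  · exact Or.inl h1
  · rcases h2 with h2 | h2
    · exact Or.inl h2
    · right
      rw [h1, h2, add_zero]

omit [Fact (1 ≤ p)] in
theorem disjointSupp_zero_right (f : Lp ℂ p μ) : DisjointSupp f 0 := by
  filter_upwards [Lp.coeFn_zero ℂ p μ] with x hx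
  exact Or.inr (by rw [hx]; rfl)

omit [Fact (1 ≤ p)] in
theorem disjointSupp_sum_right {ι : Type*} (s : Finset ι) (f : Lp ℂ p μ) (g : ι → Lp ℂ p μ)
    (h : ∀ i ∈ s, DisjointSupp f (g i)) : DisjointSupp f (∑ i ∈ s, g i) := by
  classical
  induction s using Finset.induction_on with
  | empty => simpa using disjointSupp_zero_right f
  | insert i s hi ih =>
    rw [Finset.sum_insert hi]
    exact (h i (Finset.mem_insert_self i s)).add_right
      (ih fun j hj => h j (Finset.mem_insert_of_mem hj))

theorem DisjointSupp.norm_add_rpow (hp : p ≠ ∞) {f g : Lp ℂ p μ} (h : DisjointSupp f g) :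
    ‖f + g‖ ^ p.toReal = ‖f‖ ^ p.toReal + ‖g‖ ^ p.toReal := by
  have hn : ∀ f : Lp ℂ p μ, 0 ≤ ‖f‖ ^ p.toReal := fun f => Real.rpow_nonneg (norm_nonneg _) _
  rw [← ENNReal.ofReal_eq_ofReal_iff (hn _) (add_nonneg (hn _) (hn _)),
    ENNReal.ofReal_add (hn _) (hn _), ofReal_norm_rpow hp, ofReal_norm_rpow hp,
    ofReal_norm_rpow hp, ← lintegral_add_left' ((Lp.aestronglyMeasurable f).enorm.pow_const _)]
  refine lintegral_congr_ae ?_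
  filter_upwards [h, Lp.coeFn_add f g] with x h1 h2
  rw [h2, Pi.add_apply]
  rcases h1 with h1 | h1 <;> simp [h1, toReal_pos' hp]

theorem norm_sum_rpow_of_disjointSupp (hp : p ≠ ∞) {ι : Type*} (s : Finset ι)
    (f : ι → Lp ℂ p μ) (h : ∀ i ∈ s, ∀ j ∈ s, i ≠ j → DisjointSupp (f i) (f j)) :
    ‖∑ i ∈ s, f i‖ ^ p.toReal = ∑ i ∈ s, ‖f i‖ ^ p.toReal := by
  classical
  induction s using Finset.induction_on with
  | empty => simp [(toReal_pos' hp).ne']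
  | insert i s hi ih =>
    have hd : DisjointSupp (f i) (∑ j ∈ s, f j) :=
      disjointSupp_sum_right s _ _ fun j hj => h i (Finset.mem_insert_self i s) j
        (Finset.mem_insert_of_mem hj) (fun hij => hi (hij ▸ hj))
    rw [Finset.sum_insert hi, Finset.sum_insert hi, hd.norm_add_rpow hp,
      ih fun j hj k hk => h j (Finset.mem_insert_of_mem hj) k (Finset.mem_insert_of_mem hk)]

/-- The sets `Y` and `Z` themselves may meet in a set of infinite measure without subsets of finite
positive measure, so disjointness is expressed through the projections. -/
theorem disjointSupp_of_properProj {Y Z : Set X} (hY : MeasurableSet Y) (hZ : MeasurableSet Z)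
    (h : ∀ f : Lp ℂ p μ, properProj p μ Y hY (properProj p μ Z hZ f) = 0) {f g : Lp ℂ p μ}
    (hf : properProj p μ Y hY f = f) (hg : properProj p μ Z hZ g = g) : DisjointSupp f g := by
  have h1 : properProj p μ Y hY g = 0 := by rw [← hg, h]
  rw [Lp.eq_zero_iff_ae_eq_zero] at h1
  rw [properProj_eq_self_iff] at hf
  filter_upwards [h1, hf, coeFn_properProj hY g] with x h1 h2 h3
  by_cases hx : x ∈ Y
  · right
    rw [h3, Set.indicator_of_mem hx] at h1
    exact h1
  · exact Or.inl (h2 hx)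

/-- A proper isometry has its image in a band, and bands which meet only in `0` are disjoint. -/
theorem properProj_comp_eq_zero_of_range_inter {Y Z : Set X} (hY : MeasurableSet Y)
    (hZ : MeasurableSet Z)
    (h : Set.range (properProj p μ Y hY) ∩ Set.range (properProj p μ Z hZ) = {0})
    (f : Lp ℂ p μ) : properProj p μ Y hY (properProj p μ Z hZ f) = 0 := by
  have : properProj p μ Y hY (properProj p μ Z hZ f) ∈
      Set.range (properProj p μ Y hY) ∩ Set.range (properProj p μ Z hZ) :=
    ⟨⟨_, rfl⟩, properProj p μ Y hY f, properProj_comm hZ hY f⟩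
  rwa [h] at this

end Bands

/-! ### Transport of `L_p` along measurable embeddings -/

section Embedding

variable {Z W : Type*} [MeasurableSpace Z] [MeasurableSpace W] {p : ℝ≥0∞} [Fact (1 ≤ p)]
  {μ : Measure Z} {ν : Measure W} {e : Z → W}

theorem quasiMeasurePreserving_of_map_eq (he : MeasurableEmbedding e)
    (h : μ.map e = ν.restrict (Set.range e)) : Measure.QuasiMeasurePreserving e μ ν :=
  ⟨he.measurable, by rw [h]; exact Measure.restrict_le_self.absolutelyContinuous⟩

omit [MeasurableSpace Z] [MeasurableSpace W] in
theorem extend_eq_indicator (e : Z → W) (f : Z → ℂ) :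
    Function.extend e f 0 = (Set.range e).indicator (Function.extend e f 0) := by
  ext w
  by_cases hw : w ∈ Set.range e
  · rw [Set.indicator_of_mem hw]
  · rw [Set.indicator_of_notMem hw, Function.extend_apply' _ _ _ hw]
    rfl

omit [Fact (1 ≤ p)] in
theorem eLpNorm_extend (he : MeasurableEmbedding e) (h : μ.map e = ν.restrict (Set.range e))
    (f : Z → ℂ) : eLpNorm (Function.extend e f 0) p ν = eLpNorm f p μ := by
  rw [extend_eq_indicator, eLpNorm_indicator_eq_eLpNorm_restrict he.measurableSet_range, ← h,
    he.eLpNorm_map_measure]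
  congr 1
  ext z
  exact he.injective.extend_apply _ _ _

omit [Fact (1 ≤ p)] in
theorem memLp_extend (he : MeasurableEmbedding e) (h : μ.map e = ν.restrict (Set.range e))
    (f : Lp ℂ p μ) : MemLp (Function.extend e f 0) p ν :=
  ⟨(he.stronglyMeasurable_extend (Lp.stronglyMeasurable f)
      stronglyMeasurable_zero).aestronglyMeasurable,
    by rw [eLpNorm_extend he h]; exact Lp.eLpNorm_lt_top f⟩

omit [Fact (1 ≤ p)] in
theorem memLp_comp_embedding (he : MeasurableEmbedding e)
    (h : μ.map e = ν.restrict (Set.range e)) (g : Lp ℂ p ν) : MemLp (g ∘ e) p μ := by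
  rw [← he.memLp_map_measure_iff, h]
  exact (Lp.memLp g).restrict _

theorem ae_of_ae_comp (he : MeasurableEmbedding e) (h : μ.map e = ν.restrict (Set.range e))
    {q : W → Prop} (hq : ∀ᵐ z ∂μ, q (e z)) (hq' : ∀ w ∉ Set.range e, q w) : ∀ᵐ w ∂ν, q w := by
  rw [← he.ae_map_iff, h, ae_restrict_iff' he.measurableSet_range] at hq
  filter_upwards [hq] with w hw
  by_cases hr : w ∈ Set.range e
  · exact hw hr
  · exact hq' w hr

/-- The isometry `L_p(Z) → L_p(W)` which transports functions along the embedding `e` and extends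
them by zero. -/
noncomputable def extendLp (p : ℝ≥0∞) [Fact (1 ≤ p)] (he : MeasurableEmbedding e)
    (h : μ.map e = ν.restrict (Set.range e)) : Lp ℂ p μ →ₗᵢ[ℂ] Lp ℂ p ν where
  toFun f := (memLp_extend he h f).toLp _
  map_add' f g := by
    rw [← MemLp.toLp_add]
    refine MemLp.toLp_congr _ _ (ae_of_ae_comp he h ?_ ?_)
    · filter_upwards [Lp.coeFn_add f g] with z hz
      simp only [Pi.add_apply, he.injective.extend_apply]
      exact hz
    · intro w hw
      simp [Function.extend_apply' _ _ _ hw]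
  map_smul' c f := by
    rw [RingHom.id_apply, ← MemLp.toLp_const_smul]
    refine MemLp.toLp_congr _ _ (ae_of_ae_comp he h ?_ ?_)
    · filter_upwards [Lp.coeFn_smul c f] with z hz
      simp only [Pi.smul_apply, he.injective.extend_apply]
      exact hz
    · intro w hw
      simp [Function.extend_apply' _ _ _ hw]
  norm_map' f := by
    change ‖(memLp_extend he h f).toLp _‖ = _
    rw [Lp.norm_toLp, eLpNorm_extend he h, Lp.norm_def]

/-- The restriction operator `L_p(W) → L_p(Z)`, `g ↦ g ∘ e`, a left inverse of `extendLp`. -/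
noncomputable def restrictLp (p : ℝ≥0∞) [Fact (1 ≤ p)] (he : MeasurableEmbedding e)
    (h : μ.map e = ν.restrict (Set.range e)) : Lp ℂ p ν →L[ℂ] Lp ℂ p μ :=
  LinearMap.mkContinuous
    { toFun := fun g => (memLp_comp_embedding he h g).toLp _
      map_add' := by
        intro f g
        rw [← MemLp.toLp_add]
        exact MemLp.toLp_congr _ _
          ((quasiMeasurePreserving_of_map_eq he h).ae (Lp.coeFn_add f g))
      map_smul' := by
        intro c g
        rw [RingHom.id_apply, ← MemLp.toLp_const_smul]
        exact MemLp.toLp_congr _ _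
          ((quasiMeasurePreserving_of_map_eq he h).ae (Lp.coeFn_smul c g)) }
    1 (by
      intro g
      rw [one_mul]
      change ‖(memLp_comp_embedding he h g).toLp _‖ ≤ ‖g‖
      rw [Lp.norm_toLp, Lp.norm_def, ← he.eLpNorm_map_measure, h]
      exact ENNReal.toReal_mono (Lp.eLpNorm_ne_top g) (eLpNorm_restrict_le _ _ _ _))

variable (he : MeasurableEmbedding e) (h : μ.map e = ν.restrict (Set.range e))

theorem coeFn_extendLp (f : Lp ℂ p μ) : extendLp p he h f =ᵐ[ν] Function.extend e f 0 :=
  MemLp.coeFn_toLp (memLp_extend he h f)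

theorem coeFn_restrictLp (g : Lp ℂ p ν) : restrictLp p he h g =ᵐ[μ] g ∘ e :=
  MemLp.coeFn_toLp (memLp_comp_embedding he h g)

theorem restrictLp_extendLp (f : Lp ℂ p μ) : restrictLp p he h (extendLp p he h f) = f := by
  rw [Lp.ext_iff]
  filter_upwards [coeFn_restrictLp he h (extendLp p he h f),
    (quasiMeasurePreserving_of_map_eq he h).ae (coeFn_extendLp he h f)] with z h1 h2
  rw [h1, Function.comp_apply, h2, he.injective.extend_apply]

theorem extendLp_restrictLp (g : Lp ℂ p ν) : extendLp p he h (restrictLp p he h g) =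
    properProj p ν (Set.range e) he.measurableSet_range g := by
  rw [Lp.ext_iff]
  have h3 : ∀ᵐ w ∂ν, Function.extend e (restrictLp p he h g) 0 w = (Set.range e).indicator g w := by
    refine ae_of_ae_comp he h ?_ ?_
    · filter_upwards [coeFn_restrictLp he h g] with z hz
      rw [he.injective.extend_apply, hz, Set.indicator_of_mem (Set.mem_range_self z)]
      rfl
    · intro w hw
      rw [Function.extend_apply' _ _ _ hw, Set.indicator_of_notMem hw]
      rfl
  filter_upwards [coeFn_extendLp he h (restrictLp p he h g), coeFn_properProj
    he.measurableSet_range g, h3] with w h1 h2 h3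
  rw [h1, h2, h3]

theorem extendLp_properProj {Y : Set Z} (hY : MeasurableSet Y) (f : Lp ℂ p μ) :
    extendLp p he h (properProj p μ Y hY f) =
      properProj p ν (e '' Y) (he.measurableSet_image.2 hY) (extendLp p he h f) := by
  rw [Lp.ext_iff]
  have h3 : ∀ᵐ w ∂ν, Function.extend e (properProj p μ Y hY f) 0 w =
      (e '' Y).indicator (Function.extend e f 0) w := by
    refine ae_of_ae_comp he h ?_ ?_
    · filter_upwards [coeFn_properProj hY f] with z hz
      rw [he.injective.extend_apply, hz]
      by_cases hzY : z ∈ Y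
      · rw [Set.indicator_of_mem hzY, Set.indicator_of_mem (Set.mem_image_of_mem e hzY),
          he.injective.extend_apply]
      · rw [Set.indicator_of_notMem hzY, Set.indicator_of_notMem]
        rwa [he.injective.mem_set_image]
    · intro w hw
      rw [Function.extend_apply' _ _ _ hw, Set.indicator_of_notMem]
      · rfl
      · exact fun hw' => hw (Set.image_subset_range e Y hw')
  filter_upwards [coeFn_extendLp he h (properProj p μ Y hY f), coeFn_properProj
    (he.measurableSet_image.2 hY) (extendLp p he h f), h3, coeFn_extendLp he h f] with w h1 h2 h3 h4
  rw [h1, h2, h3]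
  by_cases hw : w ∈ e '' Y
  · rw [Set.indicator_of_mem hw, Set.indicator_of_mem hw, h4]
  · rw [Set.indicator_of_notMem hw, Set.indicator_of_notMem hw]

theorem restrictLp_extendLp_eq_zero {Z' : Type*} [MeasurableSpace Z'] {μ' : Measure Z'}
    {e' : Z' → W}
    (he' : MeasurableEmbedding e') (h' : μ'.map e' = ν.restrict (Set.range e'))
    (hd : Disjoint (Set.range e') (Set.range e)) (f : Lp ℂ p μ) :
    restrictLp p he' h' (extendLp p he h f) = 0 := by
  refine (extendLp p he' h').injective ?_
  rw [map_zero, extendLp_restrictLp]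
  conv_lhs => rw [← restrictLp_extendLp he h f, extendLp_restrictLp]
  exact properProj_eq_zero_of_disjoint _ _ hd _

/-- Proper isometries stay proper after transport along a measurable embedding; a general proper
isometry need not map bands to bands if `p = 2`. -/
theorem IsProperIsometry.extendLp_comp {e : Z → Z} (he : MeasurableEmbedding e)
    (h : μ.map e = μ.restrict (Set.range e)) {I : Lp ℂ p μ →ₗᵢ[ℂ] Lp ℂ p μ}
    (hI : IsProperIsometry I) : IsProperIsometry ((extendLp p he h).comp I) := by
  obtain ⟨Y, hY, hr⟩ := hI
  refine ⟨e '' Y, he.measurableSet_image.2 hY, ?_⟩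
  have h1 : Set.range ((extendLp p he h).comp I) = extendLp p he h '' Set.range I := by
    rw [LinearIsometry.coe_comp, Set.range_comp]
  rw [h1, hr]
  ext g
  rw [mem_range_properProj_iff]
  constructor
  · rintro ⟨_, ⟨f, rfl⟩, rfl⟩
    rw [← extendLp_properProj, properProj_idem]
  · intro hg
    have h2 : properProj p μ (Set.range e) he.measurableSet_range g = g := by
      rw [properProj_eq_self_iff] at hg ⊢
      filter_upwards [hg] with x hx hx'
      exact hx fun hx'' => hx' (Set.image_subset_range e Y hx'')
    refine ⟨_, ⟨restrictLp p he h g, rfl⟩, ?_⟩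
    rw [extendLp_properProj, extendLp_restrictLp, h2, hg]

end Embedding

/-! ### The space `L_p(ℕX)` -/

section CopiesLemmas

variable {X : Type*} [MeasurableSpace X] {p : ℝ≥0∞} [Fact (1 ≤ p)] {μ : Measure X}

theorem coeFn_component (n : ℕ) (g : Lp ℂ p (copies μ)) :
    component p μ n g =ᵐ[μ] fun x => g (n, x) :=
  MemLp.coeFn_toLp (memLp_comp n (Lp.memLp g))

theorem coeFn_J (f : Lp ℂ p μ) : J p μ f =ᵐ[copies μ] extendZero f :=
  MemLp.coeFn_toLp (memLp_extendZero f)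

theorem norm_J (f : Lp ℂ p μ) : ‖J p μ f‖ = ‖f‖ := by
  change ‖(memLp_extendZero f).toLp (extendZero f)‖ = ‖f‖
  rw [Lp.norm_toLp, Lp.norm_def, eLpNorm_extendZero p (Lp.stronglyMeasurable f)]

theorem norm_Q_le : ‖Q p μ‖ ≤ 1 := by
  rw [Q, component]
  exact LinearMap.mkContinuous_norm_le _ zero_le_one _

theorem norm_properProj_le {Y : Set X} (hY : MeasurableSet Y) : ‖properProj p μ Y hY‖ ≤ 1 := by
  rw [properProj]
  exact LinearMap.mkContinuous_norm_le _ zero_le_one _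

theorem component_zero_J (f : Lp ℂ p μ) : component p μ 0 (J p μ f) = f := by
  rw [Lp.ext_iff]
  filter_upwards [coeFn_component 0 (J p μ f), (quasi_copies μ 0).ae (coeFn_J f)] with x h1 h2
  rw [h1, h2]
  simp [extendZero]

theorem component_J_of_ne_zero {n : ℕ} (hn : n ≠ 0) (f : Lp ℂ p μ) :
    component p μ n (J p μ f) = 0 := by
  rw [Lp.eq_zero_iff_ae_eq_zero]
  filter_upwards [coeFn_component n (J p μ f), (quasi_copies μ n).ae (coeFn_J f)] with x h1 h2
  rw [h1, h2]
  simp [extendZero, hn]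

theorem J_properProj {Y : Set X} (hY : MeasurableSet Y) (f : Lp ℂ p μ) :
    J p μ (properProj p μ Y hY f) =
      properProj p (copies μ) (Prod.snd ⁻¹' Y) (measurable_snd hY) (J p μ f) := by
  rw [Lp.ext_iff]
  filter_upwards [coeFn_J (properProj p μ Y hY f), ae_copies (coeFn_properProj hY f),
    coeFn_properProj (measurable_snd hY) (J p μ f), coeFn_J f] with z h1 h2 h3 h4
  rw [h1, h3]
  by_cases hz : z.2 ∈ Y
  · rw [Set.indicator_of_mem (show z ∈ Prod.snd ⁻¹' Y from hz), h4]
    simp [extendZero, h2, hz]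
  · rw [Set.indicator_of_notMem (show z ∉ Prod.snd ⁻¹' Y from hz)]
    simp [extendZero, h2, hz]

theorem lintegral_copies (F : ℕ × X → ℝ≥0∞) :
    ∫⁻ z, F z ∂(copies μ) = ∑' n, ∫⁻ z, F z ∂(μ.map (Prod.mk n)) := by
  rw [copies, lintegral_sum_measure]

theorem hasSum_norm_component_rpow (hp : p ≠ ∞) (g : Lp ℂ p (copies μ)) :
    HasSum (fun n => ‖component p μ n g‖ ^ p.toReal) (‖g‖ ^ p.toReal) := by
  have hm : ∀ n, AEMeasurable (fun z => ‖g z‖ₑ ^ p.toReal) (μ.map (Prod.mk n)) := fun n =>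
    ((Lp.stronglyMeasurable g).measurable.enorm.pow_const _).aemeasurable
  have key : ∑' n, ENNReal.ofReal (‖component p μ n g‖ ^ p.toReal) =
      ENNReal.ofReal (‖g‖ ^ p.toReal) := by
    rw [ofReal_norm_rpow hp, lintegral_copies]
    refine tsum_congr fun n => ?_
    rw [ofReal_norm_rpow hp, lintegral_map' (hm n) measurable_prodMk_left.aemeasurable]
    refine lintegral_congr_ae ?_
    filter_upwards [coeFn_component n g] with x hx
    rw [hx]
  have h0 : ∀ n, 0 ≤ ‖component p μ n g‖ ^ p.toReal := fun n => Real.rpow_nonneg (norm_nonneg _) _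
  have h1 := ENNReal.hasSum_toReal (f := fun n => ENNReal.ofReal (‖component p μ n g‖ ^ p.toReal))
    (by rw [key]; exact ENNReal.ofReal_ne_top)
  rw [← ENNReal.tsum_toReal_eq fun n => ENNReal.ofReal_ne_top, key] at h1
  simpa only [ENNReal.toReal_ofReal (h0 _),
    ENNReal.toReal_ofReal (Real.rpow_nonneg (norm_nonneg g) _)] using h1

theorem eq_zero_of_component_eq_zero (hp : p ≠ ∞) {g : Lp ℂ p (copies μ)}
    (h : ∀ n, component p μ n g = 0) : g = 0 := by
  have h1 := hasSum_norm_component_rpow hp g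
  simp only [h, norm_zero, Real.zero_rpow (toReal_pos' hp).ne'] at h1
  have h2 := h1.unique hasSum_zero
  rwa [Real.rpow_eq_zero (norm_nonneg _) (toReal_pos' hp).ne', norm_eq_zero] at h2

/-- The self-embedding of `ℕ × X` which moves the copy with index `n` to the one with
index `σ n`. -/
def shiftMap (X : Type*) (σ : ℕ → ℕ) : ℕ × X → ℕ × X := Prod.map σ id

theorem measurableEmbedding_shiftMap {σ : ℕ → ℕ} (hσ : Function.Injective σ) :
    MeasurableEmbedding (shiftMap X σ) :=
  (measurable_of_countable σ).measurableEmbedding hσ |>.prodMap MeasurableEmbedding.id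

omit [MeasurableSpace X] in
theorem range_shiftMap (σ : ℕ → ℕ) :
    Set.range (shiftMap X σ) = Set.range σ ×ˢ (Set.univ : Set X) := by
  rw [shiftMap, Set.range_prodMap, Set.range_id]

theorem map_shiftMap {σ : ℕ → ℕ} (hσ : Function.Injective σ) :
    (copies μ).map (shiftMap X σ) = (copies μ).restrict (Set.range (shiftMap X σ)) := by
  have he := measurableEmbedding_shiftMap (X := X) hσ
  ext s hs
  rw [Measure.map_apply he.measurable hs, Measure.restrict_apply hs, copies,
    Measure.sum_apply _ (he.measurable hs), Measure.sum_apply _ (hs.inter he.measurableSet_range)]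
  have h1 : ∀ n, μ.map (Prod.mk n) (shiftMap X σ ⁻¹' s) =
      μ.map (Prod.mk (σ n)) (s ∩ Set.range (shiftMap X σ)) := by
    intro n
    rw [Measure.map_apply measurable_prodMk_left (he.measurable hs),
      Measure.map_apply measurable_prodMk_left (hs.inter he.measurableSet_range), range_shiftMap]
    congr 1
    ext x
    simp [shiftMap]
  simp_rw [h1]
  refine hσ.tsum_eq (f := fun m => μ.map (Prod.mk m) (s ∩ Set.range (shiftMap X σ))) ?_
  intro m hm
  by_contra hmr
  refine hm ?_
  dsimp only
  rw [Measure.map_apply measurable_prodMk_left (hs.inter he.measurableSet_range), range_shiftMap]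
  convert measure_empty (μ := μ)
  ext x
  simpa using fun _ y hy => hmr ⟨y, hy⟩

end CopiesLemmas

/-! ### Amplifications and slices -/

section Algebra

variable {L L' L'' : Type*} [NormedAddCommGroup L] [NormedSpace ℂ L]
  [NormedAddCommGroup L'] [NormedSpace ℂ L'] [NormedAddCommGroup L''] [NormedSpace ℂ L'']
  {E F G H : Type*} [AddCommGroup E] [Module ℂ E] [AddCommGroup F] [Module ℂ F]
  [AddCommGroup G] [Module ℂ G] [AddCommGroup H] [Module ℂ H]

@[simp]
theorem act_tmul (a : L →L[ℂ] L') (ξ : L) (x : E) : act a (ξ ⊗ₜ[ℂ] x) = a ξ ⊗ₜ[ℂ] x := rfl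

theorem act_act (a : L' →L[ℂ] L'') (b : L →L[ℂ] L') (u : L ⊗[ℂ] E) :
    act a (act b u) = act (a ∘L b) u := by
  induction u with
  | zero => simp
  | tmul ξ x => simp
  | add u v hu hv => simp only [map_add, hu, hv]

theorem act_id (u : L ⊗[ℂ] E) : act (ContinuousLinearMap.id ℂ L) u = u := by
  induction u with
  | zero => simp
  | tmul ξ x => simp
  | add u v hu hv => simp only [map_add, hu, hv]

theorem act_add (a b : L →L[ℂ] L') (u : L ⊗[ℂ] E) : act (a + b) u = act a u + act b u := by
  induction u with
  | zero => simp
  | tmul ξ x => simp [TensorProduct.add_tmul]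
  | add u v hu hv => simp only [map_add, hu, hv]; abel

theorem act_smul (c : ℂ) (a : L →L[ℂ] L') (u : L ⊗[ℂ] E) : act (c • a) u = c • act a u := by
  induction u with
  | zero => simp
  | tmul ξ x => simp [TensorProduct.smul_tmul']
  | add u v hu hv => simp only [map_add, smul_add, hu, hv]

theorem act_zero (u : L ⊗[ℂ] E) : act (0 : L →L[ℂ] L') u = 0 := by
  simpa using act_smul 0 (0 : L →L[ℂ] L') u

theorem amp_act (φ : E →ₗ[ℂ] F) (a : L →L[ℂ] L') (u : L ⊗[ℂ] E) :
    amp L' φ (act a u) = act a (amp L φ u) := by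
  induction u with
  | zero => simp
  | tmul ξ x => simp [amp]
  | add u v hu hv => simp only [map_add, hu, hv]

theorem amp_ampBilin (dia : L →L[ℂ] L →L[ℂ] L) {θ : E →ₗ[ℂ] F →ₗ[ℂ] G} {ρ : E →ₗ[ℂ] F →ₗ[ℂ] H}
    {R : G →ₗ[ℂ] H} (h : ∀ x y, R (θ x y) = ρ x y) (u : L ⊗[ℂ] E) (v : L ⊗[ℂ] F) :
    amp L R (ampBilin dia θ u v) = ampBilin dia ρ u v := by
  induction u with
  | zero => simp
  | add u u' hu hu' => simp only [map_add, LinearMap.add_apply, hu, hu']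
  | tmul ξ x =>
    induction v with
    | zero => simp
    | add v v' hv hv' => simp only [map_add, hv, hv']
    | tmul η y => simp [ampBilin_tmul, amp, h]

/-- The slice map `id ⊗ g : V ⊗ E → V` of a functional `g` on `E`. -/
def sliceRight (V : Type*) [AddCommGroup V] [Module ℂ V] (g : E →ₗ[ℂ] ℂ) : V ⊗[ℂ] E →ₗ[ℂ] V :=
  (TensorProduct.rid ℂ V).toLinearMap ∘ₗ LinearMap.lTensor V g

/-- The slice map `f ⊗ id : V ⊗ E → E` of a functional `f` on `V`. -/
def sliceLeft {V : Type*} [AddCommGroup V] [Module ℂ V] (E : Type*) [AddCommGroup E] [Module ℂ E]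
    (f : V →ₗ[ℂ] ℂ) : V ⊗[ℂ] E →ₗ[ℂ] E :=
  (TensorProduct.lid ℂ E).toLinearMap ∘ₗ LinearMap.rTensor E f

variable {V : Type*} [AddCommGroup V] [Module ℂ V]

@[simp]
theorem sliceRight_tmul (g : E →ₗ[ℂ] ℂ) (ξ : V) (x : E) :
    sliceRight V g (ξ ⊗ₜ[ℂ] x) = g x • ξ := by
  simp [sliceRight]

@[simp]
theorem sliceLeft_tmul (f : V →ₗ[ℂ] ℂ) (ξ : V) (x : E) :
    sliceLeft E f (ξ ⊗ₜ[ℂ] x) = f ξ • x := by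
  simp [sliceLeft]

theorem apply_sliceRight (f : V →ₗ[ℂ] ℂ) (g : E →ₗ[ℂ] ℂ) (u : V ⊗[ℂ] E) :
    f (sliceRight V g u) = g (sliceLeft E f u) := by
  induction u with
  | zero => simp
  | tmul ξ x => simp [mul_comm]
  | add u v hu hv => simp only [map_add, hu, hv]

theorem sliceRight_act (g : E →ₗ[ℂ] ℂ) (a : L →L[ℂ] L') (u : L ⊗[ℂ] E) :
    sliceRight L' g (act a u) = a (sliceRight L g u) := by
  induction u with
  | zero => simp
  | tmul ξ x => simp
  | add u v hu hv => simp only [map_add, hu, hv]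

theorem act_smulRight (f : L →L[ℂ] ℂ) (η : L') (u : L ⊗[ℂ] E) :
    act (f.smulRight η) u = η ⊗ₜ[ℂ] sliceLeft E (f : L →ₗ[ℂ] ℂ) u := by
  induction u with
  | zero => simp
  | tmul ξ x => simp [TensorProduct.smul_tmul]
  | add u v hu hv => simp only [map_add, hu, hv, TensorProduct.tmul_add]

theorem exists_sliceLeft_ne_zero {u : V ⊗[ℂ] E} (hu : u ≠ 0) :
    ∃ f : V →ₗ[ℂ] ℂ, sliceLeft E f u ≠ 0 := by
  classical
  by_contra! h
  refine hu ((TensorProduct.equivFinsuppOfBasisLeft (N := E)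
    (Module.Basis.ofVectorSpace ℂ V)).map_eq_zero_iff.1 ?_)
  ext i
  rw [TensorProduct.equivFinsuppOfBasisLeft_apply]
  exact h _

theorem ampBilin_sliceRight (dia : L →L[ℂ] L →L[ℂ] L) (g : E →ₗ[ℂ] ℂ) (h : F →ₗ[ℂ] ℂ)
    (u : L ⊗[ℂ] E) (v : L ⊗[ℂ] F) :
    TensorProduct.rid ℂ L (ampBilin dia ((LinearMap.mul ℂ ℂ).compl₁₂ g h) u v) =
      dia (sliceRight L g u) (sliceRight L h v) := by
  induction u with
  | zero => simp
  | add u u' hu hu' => simp only [map_add, LinearMap.add_apply, add_apply, hu, hu']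
  | tmul ξ x =>
    induction v with
    | zero => simp
    | add v v' hv hv' => simp only [map_add, hv, hv']
    | tmul η y =>
      rw [ampBilin_tmul, TensorProduct.rid_tmul, sliceRight_tmul, sliceRight_tmul, map_smul,
        map_smul, smul_apply, smul_smul, mul_comm]
      rfl

end Algebra

/-! ### Norms given as functions, and near-`L`-norms -/

section NearNorms

variable {V E : Type*} [AddCommGroup V] [Module ℂ V] [AddCommGroup E] [Module ℂ E]

theorem IsNorm.map_zero {N : V → ℝ} (hN : IsNorm N) : N 0 = 0 := by
  simpa using hN.smul 0 0

theorem IsNorm.sum_le {N : V → ℝ} (hN : IsNorm N) {ι : Type*} (s : Finset ι) (u : ι → V) :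
    N (∑ i ∈ s, u i) ≤ ∑ i ∈ s, N (u i) :=
  Finset.le_sum_of_subadditive N hN.map_zero.le hN.add_le s u

/-- The Hahn–Banach theorem for a norm given as a function. -/
theorem IsNorm.exists_dual {N : V → ℝ} (hN : IsNorm N) (x : V) :
    ∃ g : V →ₗ[ℂ] ℂ, (∀ y, ‖g y‖ ≤ N y) ∧ g x = N x := by
  let : Norm V := ⟨N⟩
  have core : NormedSpace.Core ℂ V :=
    { norm_nonneg := hN.nonneg
      norm_smul := hN.smul
      norm_triangle := hN.add_le
      norm_eq_zero_iff := fun v => ⟨hN.eq_zero v, fun h => h ▸ hN.map_zero⟩ }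
  let : NormedAddCommGroup V := NormedAddCommGroup.ofCore core
  let : NormedSpace ℂ V := NormedSpace.ofCore core
  obtain ⟨g, hg, hgx⟩ := exists_dual_vector'' ℂ x
  exact ⟨g, fun y => (g.le_opNorm y).trans (mul_le_of_le_one_left (norm_nonneg _) hg), hgx⟩

/-- Tensors are separated by slices along functionals which are bounded for a given norm. -/
theorem IsNorm.exists_sliceRight_ne_zero {c : E → ℝ} (hc : IsNorm c) {u : V ⊗[ℂ] E} (hu : u ≠ 0) :
    ∃ g : E →ₗ[ℂ] ℂ, (∀ y, ‖g y‖ ≤ c y) ∧ sliceRight V g u ≠ 0 := by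
  obtain ⟨f, hf⟩ := exists_sliceLeft_ne_zero hu
  obtain ⟨g, hg, hgx⟩ := hc.exists_dual (sliceLeft E f u)
  refine ⟨g, hg, fun h => hf (hc.eq_zero _ ?_)⟩
  rw [← apply_sliceRight, h, _root_.map_zero] at hgx
  exact_mod_cast hgx.symm

variable {L : Type*} [NormedAddCommGroup L] [NormedSpace ℂ L] {N : L ⊗[ℂ] E → ℝ}

theorem rank_smulRight {f : L →L[ℂ] ℂ} {η : L} (hf : f ≠ 0) (hη : η ≠ 0) :
    (f.smulRight η : L →ₗ[ℂ] L).rank = 1 := by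
  have h1 : LinearMap.range (f.smulRight η : L →ₗ[ℂ] L) = ℂ ∙ η := by
    obtain ⟨ξ, hξ⟩ : ∃ ξ, f ξ ≠ 0 := by
      by_contra! h
      exact hf (ContinuousLinearMap.ext h)
    ext ζ
    rw [Submodule.mem_span_singleton]
    constructor
    · rintro ⟨x, rfl⟩
      exact ⟨f x, rfl⟩
    · rintro ⟨c, rfl⟩
      refine ⟨(c / f ξ) • ξ, ?_⟩
      simp only [ContinuousLinearMap.coe_coe, ContinuousLinearMap.smulRight_apply, map_smul,
        smul_smul, div_mul_cancel₀ _ hξ]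
  rw [LinearMap.rank, h1, ← Module.finrank_eq_rank, finrank_span_singleton hη, Nat.cast_one]

theorem exists_eq_smulRight {a : L →L[ℂ] L} (ha : (a : L →ₗ[ℂ] L).rank = 1) :
    ∃ (f : L →L[ℂ] ℂ) (η : L), a = f.smulRight η := by
  obtain ⟨⟨η, ξ, rfl⟩, hη0, hη⟩ := rank_eq_one_iff.1 ha
  have h0 : a ξ ≠ 0 := fun h => hη0 (Subtype.ext h)
  obtain ⟨g, -, hg⟩ := exists_dual_vector ℂ (a ξ) (norm_ne_zero_iff.2 h0)
  refine ⟨(g (a ξ))⁻¹ • g ∘L a, a ξ, ContinuousLinearMap.ext fun ζ => ?_⟩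
  obtain ⟨r, hr⟩ := hη ⟨a ζ, ζ, rfl⟩
  have hr : r • a ξ = a ζ := congrArg Subtype.val hr
  have hga : g (a ξ) ≠ 0 := by
    rw [hg]
    simpa using h0
  simp only [ContinuousLinearMap.smulRight_apply, smul_apply,
    ContinuousLinearMap.comp_apply]
  rw [← hr, map_smul, smul_eq_mul, smul_eq_mul, mul_comm r, inv_mul_cancel_left₀ hga]

theorem IsNearLNorm.act_smulRight_le (hN : IsNearLNorm N) (f : L →L[ℂ] ℂ) (η : L)
    (u : L ⊗[ℂ] E) : N (act (f.smulRight η) u) ≤ ‖f‖ * ‖η‖ * N u := by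
  by_cases hf : f = 0
  · simp [hf, act_zero, hN.isNorm.map_zero]
  by_cases hη : η = 0
  · simp [hη, act_zero, hN.isNorm.map_zero]
  rw [← ContinuousLinearMap.norm_smulRight_apply]
  exact hN.act_le _ (rank_smulRight hf hη) u

theorem IsLNorm.isNearLNorm (hN : IsLNorm N) : IsNearLNorm N :=
  ⟨hN.isNorm, fun a _ => hN.act_le a⟩

theorem IsNearLNorm.tmul_eq (hN : IsNearLNorm N) {e : L} (he : ‖e‖ = 1) (ξ : L) (x : E) :
    N (ξ ⊗ₜ x) = ‖ξ‖ * N (e ⊗ₜ x) := by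
  by_cases hξ : ξ = 0
  · simp [hξ, hN.isNorm.map_zero]
  have key : ∀ ξ η : L, ξ ≠ 0 → ‖ξ‖ * N (η ⊗ₜ x) ≤ ‖η‖ * N (ξ ⊗ₜ x) := by
    intro ξ η hξ
    obtain ⟨f, hf1, hf⟩ := exists_dual_vector ℂ ξ (norm_ne_zero_iff.2 hξ)
    have := hN.act_smulRight_le f η (ξ ⊗ₜ x)
    rw [hf1, one_mul] at this
    refine le_trans (le_of_eq ?_) this
    rw [act_tmul, ContinuousLinearMap.smulRight_apply, hf, ← TensorProduct.smul_tmul',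
      hN.isNorm.smul]
    simp
  have he0 : e ≠ 0 := norm_ne_zero_iff.1 (by rw [he]; exact one_ne_zero)
  have h1 := key ξ e hξ
  have h2 := key e ξ he0
  rw [he, one_mul] at h1 h2
  exact le_antisymm h2 h1

/-- The norm which a near-`L`-norm induces on `E` by means of a unit vector of `L`. -/
theorem IsNearLNorm.isNorm_tmul (hN : IsNearLNorm N) {e : L} (he : ‖e‖ = 1) :
    IsNorm fun x : E => N (e ⊗ₜ x) where
  nonneg x := hN.isNorm.nonneg _
  add_le x y := by
    rw [TensorProduct.tmul_add]
    exact hN.isNorm.add_le _ _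
  smul c x := by
    rw [TensorProduct.tmul_smul]
    exact hN.isNorm.smul _ _
  eq_zero x hx := by
    have h0 := hN.isNorm.eq_zero _ hx
    obtain ⟨f, -, hf⟩ := exists_dual_vector ℂ e (by rw [he]; exact one_ne_zero)
    have h1 := sliceLeft_tmul (f : L →ₗ[ℂ] ℂ) e x
    rw [h0, map_zero] at h1
    have h2 : (f : L →ₗ[ℂ] ℂ) e = 1 := by
      rw [ContinuousLinearMap.coe_coe, hf, he]
      simp
    rw [h2, one_smul] at h1
    exact h1.symm

/-- Contractive functionals on `E` are automatically `L`-contractive. -/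
theorem IsNearLNorm.norm_sliceRight_le (hN : IsNearLNorm N) {e : L} (he : ‖e‖ = 1)
    {g : E →ₗ[ℂ] ℂ} (hg : ∀ y, ‖g y‖ ≤ N (e ⊗ₜ y)) (u : L ⊗[ℂ] E) :
    ‖sliceRight L g u‖ ≤ N u := by
  obtain ⟨f, hf1, hf⟩ := exists_dual_vector'' ℂ (sliceRight L g u)
  have h1 : ‖sliceRight L g u‖ = ‖f (sliceRight L g u)‖ := by
    rw [hf]
    simp
  have h2 : f (sliceRight L g u) = g (sliceLeft E (f : L →ₗ[ℂ] ℂ) u) :=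
    apply_sliceRight (f : L →ₗ[ℂ] ℂ) g u
  rw [h1, h2]
  calc ‖g (sliceLeft E (f : L →ₗ[ℂ] ℂ) u)‖ ≤ N (e ⊗ₜ sliceLeft E (f : L →ₗ[ℂ] ℂ) u) := hg _
    _ = N (act (f.smulRight e) u) := by rw [act_smulRight]
    _ ≤ ‖f‖ * ‖e‖ * N u := hN.act_smulRight_le f e u
    _ ≤ N u := by
      rw [he, mul_one]
      exact mul_le_of_le_one_left (hN.isNorm.nonneg u) hf1

end NearNorms

/-! ### Standard extensions to `L_p(ℕX)` -/

section StdExt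

variable {X : Type*} [MeasurableSpace X] {p : ℝ≥0∞} [Fact (1 ≤ p)] {μ : Measure X}
  {E : Type*} [AddCommGroup E] [Module ℂ E] {N : Lp ℂ p μ ⊗[ℂ] E → ℝ}

theorem exists_norm_eq_one_of_not_finiteDimensional {L : Type*} [NormedAddCommGroup L]
    [NormedSpace ℂ L] (hL : ¬ FiniteDimensional ℂ L) : ∃ e : L, ‖e‖ = 1 := by
  have : Nontrivial L := by
    by_contra h
    rw [not_nontrivial_iff_subsingleton] at h
    exact hL inferInstance
  obtain ⟨x, hx⟩ := exists_ne (0 : L)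
  exact ⟨_, norm_smul_inv_norm (𝕜 := ℂ) hx⟩

theorem summable_component_rpow (hp : p ≠ ∞) {e : Lp ℂ p μ} (he : ‖e‖ = 1) (hN : IsNearLNorm N)
    (u : Lp ℂ p (copies μ) ⊗[ℂ] E) :
    Summable fun n => N (act (component p μ n) u) ^ p.toReal := by
  induction u with
  | zero => simp [hN.isNorm.map_zero, (toReal_pos' hp).ne']
  | tmul ξ x =>
    simp only [act_tmul]
    simp_rw [hN.tmul_eq he (component p μ _ ξ) x]
    simp_rw [Real.mul_rpow (norm_nonneg _) (hN.isNorm.nonneg _)]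
    exact (hasSum_norm_component_rpow hp ξ).summable.mul_right _
  | add u v hu hv =>
    refine Summable.of_nonneg_of_le (fun n => Real.rpow_nonneg (hN.isNorm.nonneg _) _) (fun n => ?_)
      (Real.summable_Lp_add_of_nonneg (one_le_toReal hp) (fun n => hN.isNorm.nonneg _)
        (fun n => hN.isNorm.nonneg _) hu hv)
    rw [map_add]
    exact Real.rpow_le_rpow (hN.isNorm.nonneg _) (hN.isNorm.add_le _ _) (toReal_pos' hp).le

theorem stdExt_nonneg (hN : ∀ u, 0 ≤ N u) (u : Lp ℂ p (copies μ) ⊗[ℂ] E) : 0 ≤ stdExt N u :=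
  Real.rpow_nonneg (tsum_nonneg fun _ => Real.rpow_nonneg (hN _) _) _

theorem stdExt_rpow (hp : p ≠ ∞) (hN : ∀ u, 0 ≤ N u) (u : Lp ℂ p (copies μ) ⊗[ℂ] E) :
    stdExt N u ^ p.toReal = ∑' n, N (act (component p μ n) u) ^ p.toReal := by
  rw [stdExt, ← Real.rpow_mul (tsum_nonneg fun _ => Real.rpow_nonneg (hN _) _), one_div,
    inv_mul_cancel₀ (toReal_pos' hp).ne', Real.rpow_one]

theorem le_stdExt_component (hp : p ≠ ∞) {e : Lp ℂ p μ} (he : ‖e‖ = 1) (hN : IsNearLNorm N)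
    (n : ℕ) (u : Lp ℂ p (copies μ) ⊗[ℂ] E) : N (act (component p μ n) u) ≤ stdExt N u := by
  rw [← Real.rpow_le_rpow_iff (hN.isNorm.nonneg _) (stdExt_nonneg hN.isNorm.nonneg u)
    (toReal_pos' hp), stdExt_rpow hp hN.isNorm.nonneg]
  exact (summable_component_rpow hp he hN u).le_tsum n
    fun m _ => Real.rpow_nonneg (hN.isNorm.nonneg _) _

theorem act_component_zero_act_J (u : Lp ℂ p μ ⊗[ℂ] E) :
    act (component p μ 0) (act (J p μ) u) = u := by
  rw [act_act, show component p μ 0 ∘L J p μ = ContinuousLinearMap.id ℂ _ from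
    ContinuousLinearMap.ext component_zero_J, act_id]

theorem stdExt_act_J (hp : p ≠ ∞) (hN : IsNorm N) (u : Lp ℂ p μ ⊗[ℂ] E) :
    stdExt N (act (J p μ) u) = N u := by
  have h : ∀ n, n ≠ 0 → N (act (component p μ n) (act (J p μ) u)) ^ p.toReal = 0 := by
    intro n hn
    rw [act_act, show component p μ n ∘L J p μ = 0 from
      ContinuousLinearMap.ext (component_J_of_ne_zero hn), act_zero, hN.map_zero,
      Real.zero_rpow (toReal_pos' hp).ne']
  rw [stdExt, tsum_eq_single 0 h, act_component_zero_act_J, ← Real.rpow_mul (hN.nonneg u),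
    one_div, mul_inv_cancel₀ (toReal_pos' hp).ne', Real.rpow_one]

theorem isNorm_stdExt (hp : p ≠ ∞) {e : Lp ℂ p μ} (he : ‖e‖ = 1) (hN : IsNearLNorm N) :
    IsNorm (stdExt N) where
  nonneg := stdExt_nonneg hN.isNorm.nonneg
  add_le u v := by
    refine le_trans ?_ (Real.Lp_add_le_tsum_of_nonneg' (one_le_toReal hp)
      (fun n => hN.isNorm.nonneg _) (fun n => hN.isNorm.nonneg _)
      (summable_component_rpow hp he hN u) (summable_component_rpow hp he hN v))
    refine Real.rpow_le_rpow (tsum_nonneg fun _ => Real.rpow_nonneg (hN.isNorm.nonneg _) _) ?_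
      (by simp)
    refine (summable_component_rpow hp he hN _).tsum_le_tsum (fun n => ?_)
      (Real.summable_Lp_add_of_nonneg (one_le_toReal hp) (fun n => hN.isNorm.nonneg _)
        (fun n => hN.isNorm.nonneg _) (summable_component_rpow hp he hN u)
        (summable_component_rpow hp he hN v))
    rw [map_add]
    exact Real.rpow_le_rpow (hN.isNorm.nonneg _) (hN.isNorm.add_le _ _) (toReal_pos' hp).le
  smul c u := by
    rw [stdExt, stdExt]
    simp_rw [map_smul, hN.isNorm.smul, Real.mul_rpow (norm_nonneg c) (hN.isNorm.nonneg _)]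
    rw [tsum_mul_left, Real.mul_rpow (Real.rpow_nonneg (norm_nonneg c) _)
      (tsum_nonneg fun _ => Real.rpow_nonneg (hN.isNorm.nonneg _) _), ← Real.rpow_mul
      (norm_nonneg c), one_div, mul_inv_cancel₀ (toReal_pos' hp).ne', Real.rpow_one]
  eq_zero u hu := by
    have h1 : ∀ n, act (component p μ n) u = 0 := fun n => hN.isNorm.eq_zero _
      (le_antisymm (hu ▸ le_stdExt_component hp he hN n u) (hN.isNorm.nonneg _))
    by_contra h0
    obtain ⟨g, -, hg⟩ := (hN.isNorm_tmul he).exists_sliceRight_ne_zero h0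
    refine hg (eq_zero_of_component_eq_zero hp fun n => ?_)
    rw [← sliceRight_act, h1, map_zero]

/-- For `a = f ⊗ η` one has `a · u = η ⊗ x` with `x = (f ⊗ id) u`; a functional `g` on `E` which
norms `x` reduces the estimate of `x` to one of the single function `(id ⊗ g) u`. -/
theorem isNearLNorm_stdExt (hp : p ≠ ∞) {e : Lp ℂ p μ} (he : ‖e‖ = 1) (hN : IsNearLNorm N) :
    IsNearLNorm (stdExt N) where
  isNorm := isNorm_stdExt hp he hN
  act_le a ha u := by
    obtain ⟨f, η, rfl⟩ := exists_eq_smulRight ha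
    rw [act_smulRight, ContinuousLinearMap.norm_smulRight_apply]
    set x := sliceLeft E (f : Lp ℂ p (copies μ) →ₗ[ℂ] ℂ) u with hx
    have h1 : stdExt N (η ⊗ₜ x) = ‖η‖ * N (e ⊗ₜ x) := by
      rw [stdExt]
      simp only [act_tmul]
      simp_rw [hN.tmul_eq he (component p μ _ η) x,
        Real.mul_rpow (norm_nonneg _) (hN.isNorm.nonneg _)]
      rw [tsum_mul_right, (hasSum_norm_component_rpow hp η).tsum_eq,
        ← Real.mul_rpow (norm_nonneg _) (hN.isNorm.nonneg _),
        ← Real.rpow_mul (mul_nonneg (norm_nonneg _) (hN.isNorm.nonneg _)), one_div,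
        mul_inv_cancel₀ (toReal_pos' hp).ne', Real.rpow_one]
    obtain ⟨g, hg, hgx⟩ := (hN.isNorm_tmul he).exists_dual x
    have h2 : ‖sliceRight _ g u‖ ≤ stdExt N u := by
      rw [← Real.rpow_le_rpow_iff (norm_nonneg _) (stdExt_nonneg hN.isNorm.nonneg u)
        (toReal_pos' hp), stdExt_rpow hp hN.isNorm.nonneg,
        ← (hasSum_norm_component_rpow hp _).tsum_eq]
      refine (hasSum_norm_component_rpow hp _).summable.tsum_le_tsum (fun n => ?_)
        (summable_component_rpow hp he hN u)
      rw [← sliceRight_act]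
      exact Real.rpow_le_rpow (norm_nonneg _) (hN.norm_sliceRight_le he hg _) (toReal_pos' hp).le
    have h3 : N (e ⊗ₜ x) ≤ ‖f‖ * stdExt N u := by
      have h4 : ((N (e ⊗ₜ x) : ℝ) : ℂ) = f (sliceRight _ g u) := by
        rw [← hgx, hx]
        exact (apply_sliceRight (f : Lp ℂ p (copies μ) →ₗ[ℂ] ℂ) g u).symm
      calc N (e ⊗ₜ x) = ‖((N (e ⊗ₜ x) : ℝ) : ℂ)‖ := by
            rw [Complex.norm_real, Real.norm_of_nonneg (hN.isNorm.nonneg _)]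
        _ = ‖f (sliceRight _ g u)‖ := by rw [h4]
        _ ≤ ‖f‖ * ‖sliceRight _ g u‖ := f.le_opNorm _
        _ ≤ ‖f‖ * stdExt N u := mul_le_mul_of_nonneg_left h2 (norm_nonneg _)
    rw [h1]
    calc ‖η‖ * N (e ⊗ₜ x) ≤ ‖η‖ * (‖f‖ * stdExt N u) :=
          mul_le_mul_of_nonneg_left h3 (norm_nonneg _)
      _ = ‖f‖ * ‖η‖ * stdExt N u := by ring

end StdExt

/-! ### Disjoint sums of diamond products and the basic estimate -/

section Estimate

variable {X : Type*} [MeasurableSpace X] {p : ℝ≥0∞} [Fact (1 ≤ p)] {μ : Measure X}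
  {E F G : Type*} [AddCommGroup E] [Module ℂ E] [AddCommGroup F] [Module ℂ F]
  [AddCommGroup G] [Module ℂ G]
  {dia : Lp ℂ p μ →L[ℂ] Lp ℂ p μ →L[ℂ] Lp ℂ p μ}
  {NE : Lp ℂ p μ ⊗[ℂ] E → ℝ} {NF : Lp ℂ p μ ⊗[ℂ] F → ℝ} {NG : Lp ℂ p μ ⊗[ℂ] G → ℝ}

theorem rpow_one_div_rpow {x q : ℝ} (hx : 0 ≤ x) (hq : 0 < q) : (x ^ (1 / q)) ^ q = x := by
  rw [← Real.rpow_mul hx, one_div, inv_mul_cancel₀ hq.ne', Real.rpow_one]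

theorem rpow_rpow_one_div {x q : ℝ} (hx : 0 ≤ x) (hq : 0 < q) : (x ^ q) ^ (1 / q) = x := by
  rw [← Real.rpow_mul hx, one_div, mul_inv_cancel₀ hq.ne', Real.rpow_one]

/-- `W` is a sum `∑ I_k · (u_k ⋄ v_k)` with pairwise disjoint proper isometries `I_k`, and
`A = ∑ ‖u_k‖ ^ p ‖v_k‖ ^ p`. -/
def DisjointSum (dia : Lp ℂ p μ →L[ℂ] Lp ℂ p μ →L[ℂ] Lp ℂ p μ)
    (NE : Lp ℂ p μ ⊗[ℂ] E → ℝ) (NF : Lp ℂ p μ ⊗[ℂ] F → ℝ) (A : ℝ)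
    (W : Lp ℂ p μ ⊗[ℂ] (E ⊗[ℂ] F)) : Prop :=
  ∃ (n : ℕ) (I : Fin n → Lp ℂ p μ →ₗᵢ[ℂ] Lp ℂ p μ)
    (u : Fin n → Lp ℂ p μ ⊗[ℂ] E) (v : Fin n → Lp ℂ p μ ⊗[ℂ] F),
    (∀ k, IsProperIsometry (I k)) ∧
    (∀ j k, j ≠ k → Set.range (I j) ∩ Set.range (I k) = {0}) ∧
    W = ∑ k, act (I k).toContinuousLinearMap
      (ampBilin dia (TensorProduct.mk ℂ E F) (u k) (v k)) ∧
    A = ∑ k, NE (u k) ^ p.toReal * NF (v k) ^ p.toReal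

theorem mem_reprValues_iff {U : Lp ℂ p μ ⊗[ℂ] (E ⊗[ℂ] F)} {r : ℝ} :
    r ∈ reprValues dia NE NF U ↔ ∃ (a : Lp ℂ p μ →L[ℂ] Lp ℂ p μ) (A : ℝ)
      (W : Lp ℂ p μ ⊗[ℂ] (E ⊗[ℂ] F)),
      DisjointSum dia NE NF A W ∧ U = act a W ∧ r = ‖a‖ * A ^ (1 / p.toReal) := by
  constructor
  · rintro ⟨n, a, I, u, v, hI, hd, hU, hr⟩
    exact ⟨a, _, _, ⟨n, I, u, v, hI, hd, rfl, rfl⟩, hU, hr⟩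
  · rintro ⟨a, A, W, ⟨n, I, u, v, hI, hd, rfl, rfl⟩, hU, hr⟩
    exact ⟨n, a, I, u, v, hI, hd, hU, hr⟩

theorem DisjointSum.nonneg (hE : IsNorm NE) (hF : IsNorm NF) {A : ℝ}
    {W : Lp ℂ p μ ⊗[ℂ] (E ⊗[ℂ] F)} (h : DisjointSum dia NE NF A W) : 0 ≤ A := by
  obtain ⟨n, I, u, v, hI, hd, hW, rfl⟩ := h
  exact Finset.sum_nonneg fun k _ =>
    mul_nonneg (Real.rpow_nonneg (hE.nonneg _) _) (Real.rpow_nonneg (hF.nonneg _) _)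

theorem DisjointSum.smul (hE : IsNorm NE) {A : ℝ}
    {W : Lp ℂ p μ ⊗[ℂ] (E ⊗[ℂ] F)} (h : DisjointSum dia NE NF A W) (c : ℂ) :
    DisjointSum dia NE NF (‖c‖ ^ p.toReal * A) (c • W) := by
  obtain ⟨n, I, u, v, hI, hd, rfl, rfl⟩ := h
  refine ⟨n, I, fun k => c • u k, v, hI, hd, ?_, ?_⟩
  · rw [Finset.smul_sum]
    simp only [map_smul, LinearMap.smul_apply]
  · rw [Finset.mul_sum]
    refine Finset.sum_congr rfl fun k _ => ?_
    rw [hE.smul, Real.mul_rpow (norm_nonneg c) (hE.nonneg _), mul_assoc]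

theorem disjointSum_zero : DisjointSum dia NE NF 0 0 :=
  ⟨0, fun k => k.elim0, fun k => k.elim0, fun k => k.elim0, fun k => k.elim0, fun k => k.elim0,
    by simp, by simp⟩

theorem disjointSum_ampBilin (u : Lp ℂ p μ ⊗[ℂ] E) (v : Lp ℂ p μ ⊗[ℂ] F) :
    DisjointSum dia NE NF (NE u ^ p.toReal * NF v ^ p.toReal)
      (ampBilin dia (TensorProduct.mk ℂ E F) u v) := by
  refine ⟨1, fun _ => LinearIsometry.id, fun _ => u, fun _ => v, fun _ => ⟨Set.univ,
    MeasurableSet.univ, ?_⟩, fun j k hjk => (hjk (Subsingleton.elim j k)).elim, ?_, ?_⟩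
  · ext f
    rw [mem_range_properProj_iff, properProj_univ]
    simp
  · rw [Fin.sum_univ_one]
    exact (act_id _).symm
  · rw [Fin.sum_univ_one]

/-- The `p`-convexity inequality for finitely many summands. -/
theorem IsPConvex.sum_rpow_le (hp : p ≠ ∞) (hN : IsNorm NG) (hc : IsPConvex NG) {ι : Type*}
    (s : Finset ι) (Y : ι → Set X) (hY : ∀ i, MeasurableSet (Y i))
    (hd : ∀ i j, i ≠ j → ∀ f : Lp ℂ p μ,
      properProj p μ (Y i) (hY i) (properProj p μ (Y j) (hY j) f) = 0)
    (w : ι → Lp ℂ p μ ⊗[ℂ] G) (hw : ∀ i, act (properProj p μ (Y i) (hY i)) (w i) = w i) :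
    NG (∑ i ∈ s, w i) ^ p.toReal ≤ ∑ i ∈ s, NG (w i) ^ p.toReal := by
  classical
  have hq := toReal_pos' hp
  suffices h : ∃ (Z : Set X) (hZ : MeasurableSet Z),
      (∀ i ∉ s, ∀ f : Lp ℂ p μ, properProj p μ (Y i) (hY i) (properProj p μ Z hZ f) = 0) ∧
      act (properProj p μ Z hZ) (∑ i ∈ s, w i) = ∑ i ∈ s, w i ∧
      NG (∑ i ∈ s, w i) ^ p.toReal ≤ ∑ i ∈ s, NG (w i) ^ p.toReal by
    obtain ⟨-, -, -, -, h⟩ := h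
    exact h
  induction s using Finset.induction_on with
  | empty =>
    refine ⟨∅, MeasurableSet.empty, fun i _ f => ?_, ?_, ?_⟩
    · rw [properProj_empty, map_zero]
    · simp
    · simp [hN.map_zero, hq.ne']
  | insert i s hi ih =>
    obtain ⟨Z, hZ, hZY, hZw, hle⟩ := ih
    have hYZ : ∀ f : Lp ℂ p μ, properProj p μ (Y i) (hY i) (properProj p μ Z hZ f) = 0 := hZY i hi
    have hZY' : ∀ f : Lp ℂ p μ, properProj p μ Z hZ (properProj p μ (Y i) (hY i) f) = 0 := by
      intro f
      rw [properProj_comm, hYZ]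
    have hun : properProj p μ (Y i ∪ Z) ((hY i).union hZ) =
        properProj p μ (Y i) (hY i) + properProj p μ Z hZ := by
      refine ContinuousLinearMap.ext fun f => ?_
      rw [properProj_union, hYZ, sub_zero]
      rfl
    refine ⟨Y i ∪ Z, (hY i).union hZ, fun j hj f => ?_, ?_, ?_⟩
    · rw [Finset.mem_insert, not_or] at hj
      rw [hun, add_apply, map_add, hd j i hj.1, hZY j hj.2, add_zero]
    · have h1 : act (properProj p μ (Y i) (hY i)) (∑ j ∈ s, w j) = 0 := by
        rw [← hZw, act_act, show properProj p μ (Y i) (hY i) ∘L properProj p μ Z hZ = 0 from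
          ContinuousLinearMap.ext hYZ, act_zero]
      have h2 : act (properProj p μ Z hZ) (w i) = 0 := by
        rw [← hw i, act_act, show properProj p μ Z hZ ∘L properProj p μ (Y i) (hY i) = 0 from
          ContinuousLinearMap.ext hZY', act_zero]
      rw [hun, Finset.sum_insert hi, act_add, map_add, map_add, hw, hZw, h1, h2, add_zero, zero_add]
    · rw [Finset.sum_insert hi, Finset.sum_insert hi]
      have h1 := hc (Y i) Z (hY i) hZ (ContinuousLinearMap.ext hYZ) (ContinuousLinearMap.ext hZY')
        (w i) (∑ j ∈ s, w j) (hw i) hZw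
      have h2 := Real.rpow_le_rpow (hN.nonneg _) h1 hq.le
      rw [rpow_one_div_rpow (add_nonneg (Real.rpow_nonneg (hN.nonneg _) _)
        (Real.rpow_nonneg (hN.nonneg _) _)) hq] at h2
      exact h2.trans (add_le_add_right hle _)

/-- A bilinear map into a `p`-convex `L`-space with bound `C` has its linearization bounded by `C`
on every representation. -/
theorem norm_amp_lift_le_of_mem_reprValues (hp : p ≠ ∞) (hE : IsNorm NE) (hF : IsNorm NF)
    (hN : IsLNorm NG) (hc : IsPConvex NG) {ρ : E →ₗ[ℂ] F →ₗ[ℂ] G} {C : ℝ} (hC : 0 ≤ C)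
    (hρ : ∀ u v, NG (ampBilin dia ρ u v) ≤ C * (NE u * NF v))
    {U : Lp ℂ p μ ⊗[ℂ] (E ⊗[ℂ] F)} {r : ℝ} (hr : r ∈ reprValues dia NE NF U) :
    NG (amp (Lp ℂ p μ) (TensorProduct.lift ρ) U) ≤ C * r := by
  obtain ⟨n, a, I, u, v, hI, hd, rfl, rfl⟩ := hr
  have hq := toReal_pos' hp
  choose Y hY hr using hI
  have hR : ∀ x y, TensorProduct.lift ρ (TensorProduct.mk ℂ E F x y) = ρ x y := fun x y => rfl
  rw [amp_act, map_sum]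
  simp only [amp_act, amp_ampBilin dia hR]
  set w := fun k => ampBilin dia ρ (u k) (v k) with hw
  have hfix : ∀ k, act (properProj p μ (Y k) (hY k)) (act (I k).toContinuousLinearMap (w k)) =
      act (I k).toContinuousLinearMap (w k) := by
    intro k
    rw [act_act]
    congr 2
    refine ContinuousLinearMap.ext fun f => ?_
    rw [ContinuousLinearMap.comp_apply, ← mem_range_properProj_iff, ← hr k]
    exact ⟨f, rfl⟩
  have hdisj : ∀ j k, j ≠ k → ∀ f : Lp ℂ p μ,
      properProj p μ (Y j) (hY j) (properProj p μ (Y k) (hY k) f) = 0 := by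
    intro j k hjk
    refine properProj_comp_eq_zero_of_range_inter (hY j) (hY k) ?_
    rw [← hr j, ← hr k, hd j k hjk]
  have h1 := hc.sum_rpow_le hp hN.isNorm Finset.univ Y hY hdisj _ hfix
  have h2 : ∀ k, NG (act (I k).toContinuousLinearMap (w k)) ^ p.toReal ≤
      C ^ p.toReal * (NE (u k) ^ p.toReal * NF (v k) ^ p.toReal) := by
    intro k
    rw [← Real.mul_rpow (hE.nonneg _) (hF.nonneg _), ← Real.mul_rpow hC
      (mul_nonneg (hE.nonneg _) (hF.nonneg _))]
    refine Real.rpow_le_rpow (hN.isNorm.nonneg _) ?_ hq.le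
    calc NG (act (I k).toContinuousLinearMap (w k))
        ≤ ‖(I k).toContinuousLinearMap‖ * NG (w k) := hN.act_le _ _
      _ ≤ NG (w k) := mul_le_of_le_one_left (hN.isNorm.nonneg _) (I k).norm_toContinuousLinearMap_le
      _ ≤ C * (NE (u k) * NF (v k)) := hρ _ _
  have h3 : 0 ≤ ∑ k, NE (u k) ^ p.toReal * NF (v k) ^ p.toReal :=
    Finset.sum_nonneg fun k _ =>
      mul_nonneg (Real.rpow_nonneg (hE.nonneg _) _) (Real.rpow_nonneg (hF.nonneg _) _)
  have h4 : NG (∑ k, act (I k).toContinuousLinearMap (w k)) ≤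
      C * (∑ k, NE (u k) ^ p.toReal * NF (v k) ^ p.toReal) ^ (1 / p.toReal) := by
    rw [← Real.rpow_le_rpow_iff (hN.isNorm.nonneg _)
      (mul_nonneg hC (Real.rpow_nonneg h3 _)) hq, Real.mul_rpow hC (Real.rpow_nonneg h3 _),
      rpow_one_div_rpow h3 hq, Finset.mul_sum]
    exact h1.trans (Finset.sum_le_sum fun k _ => h2 k)
  calc _ ≤ ‖a‖ * NG (∑ k, act (I k).toContinuousLinearMap (w k)) := hN.act_le _ _
    _ ≤ ‖a‖ * (C * (∑ k, NE (u k) ^ p.toReal * NF (v k) ^ p.toReal) ^ (1 / p.toReal)) :=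
      mul_le_mul_of_nonneg_left h4 (norm_nonneg a)
    _ = _ := by ring

theorem nonneg_of_mem_reprValues (hE : IsNorm NE) (hF : IsNorm NF)
    {U : Lp ℂ p μ ⊗[ℂ] (E ⊗[ℂ] F)} {r : ℝ} (hr : r ∈ reprValues dia NE NF U) : 0 ≤ r := by
  obtain ⟨a, A, W, hA, -, rfl⟩ := mem_reprValues_iff.1 hr
  exact mul_nonneg (norm_nonneg a) (Real.rpow_nonneg (hA.nonneg hE hF) _)

theorem pTensorNorm_nonneg (hE : IsNorm NE) (hF : IsNorm NF) (U : Lp ℂ p μ ⊗[ℂ] (E ⊗[ℂ] F)) :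
    0 ≤ pTensorNorm dia NE NF U :=
  Real.sInf_nonneg fun _ hr => nonneg_of_mem_reprValues hE hF hr

theorem pTensorNorm_le_of_mem (hE : IsNorm NE) (hF : IsNorm NF)
    {U : Lp ℂ p μ ⊗[ℂ] (E ⊗[ℂ] F)} {r : ℝ} (hr : r ∈ reprValues dia NE NF U) :
    pTensorNorm dia NE NF U ≤ r :=
  csInf_le ⟨0, fun _ hr => nonneg_of_mem_reprValues hE hF hr⟩ hr

theorem le_mul_pTensorNorm {U : Lp ℂ p μ ⊗[ℂ] (E ⊗[ℂ] F)}
    (hne : (reprValues dia NE NF U).Nonempty) {C x : ℝ} (hC : 0 ≤ C)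
    (h : ∀ r ∈ reprValues dia NE NF U, x ≤ C * r) : x ≤ C * pTensorNorm dia NE NF U := by
  rcases hC.eq_or_lt with rfl | hC
  · obtain ⟨r, hr⟩ := hne
    simpa using h r hr
  · rw [← div_le_iff₀' hC]
    exact le_csInf hne fun r hr => (div_le_iff₀' hC).2 (h r hr)

theorem pTensorNorm_ampBilin_le (hp : p ≠ ∞) (hE : IsNorm NE) (hF : IsNorm NF)
    (u : Lp ℂ p μ ⊗[ℂ] E) (v : Lp ℂ p μ ⊗[ℂ] F) :
    pTensorNorm dia NE NF (ampBilin dia (TensorProduct.mk ℂ E F) u v) ≤ NE u * NF v := by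
  have h0 := mul_nonneg (hE.nonneg u) (hF.nonneg v)
  refine (pTensorNorm_le_of_mem hE hF (mem_reprValues_iff.2
    ⟨ContinuousLinearMap.id ℂ _, _, _, disjointSum_ampBilin u v, (act_id _).symm, rfl⟩)).trans ?_
  rw [← Real.mul_rpow (hE.nonneg _) (hF.nonneg _), rpow_rpow_one_div h0 (toReal_pos' hp)]
  exact mul_le_of_le_one_left h0 ContinuousLinearMap.norm_id_le

theorem rid_act (a : Lp ℂ p μ →L[ℂ] Lp ℂ p μ) (u : Lp ℂ p μ ⊗[ℂ] ℂ) :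
    TensorProduct.rid ℂ _ (act a u) = a (TensorProduct.rid ℂ _ u) := by
  induction u with
  | zero => simp
  | tmul ξ x => simp
  | add u v hu hv => simp only [map_add, hu, hv]

theorem isLNorm_rid : IsLNorm fun u : Lp ℂ p μ ⊗[ℂ] ℂ => ‖TensorProduct.rid ℂ _ u‖ where
  isNorm :=
    { nonneg := fun u => norm_nonneg _
      add_le := fun u v => by
        rw [map_add]
        exact norm_add_le _ _
      smul := fun c u => by rw [map_smul, norm_smul]
      eq_zero := fun u hu => by
        rwa [norm_eq_zero, LinearEquiv.map_eq_zero_iff] at hu }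
  act_le a u := by
    rw [rid_act]
    exact a.le_opNorm _

theorem isPConvex_rid (hp : p ≠ ∞) :
    IsPConvex fun u : Lp ℂ p μ ⊗[ℂ] ℂ => ‖TensorProduct.rid ℂ _ u‖ := by
  intro Y Z hY hZ hYZ _ u v hu hv
  have h1 := disjointSupp_of_properProj hY hZ (fun f => by
      rw [← ContinuousLinearMap.comp_apply, hYZ]
      rfl)
    (show properProj p μ Y hY (TensorProduct.rid ℂ _ u) = _ by rw [← rid_act, hu])
    (show properProj p μ Z hZ (TensorProduct.rid ℂ _ v) = _ by rw [← rid_act, hv])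
  rw [← h1.norm_add_rpow hp, rpow_rpow_one_div (norm_nonneg _) (toReal_pos' hp)]
  exact (congrArg norm (map_add _ u v)).le

/-- Definiteness: `U` is tested against the bounded bilinear functionals `g ⊗ h`, the space `ℂ`
being a `p`-convex `L`-space. -/
theorem eq_zero_of_pTensorNorm_eq_zero (hp : p ≠ ∞) {e : Lp ℂ p μ} (he : ‖e‖ = 1)
    (hE : IsNearLNorm NE) (hF : IsNearLNorm NF) {U : Lp ℂ p μ ⊗[ℂ] (E ⊗[ℂ] F)}
    (hne : (reprValues dia NE NF U).Nonempty) (hU : pTensorNorm dia NE NF U = 0) : U = 0 := by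
  by_contra h0
  have h1 : (TensorProduct.assoc ℂ (Lp ℂ p μ) E F).symm U ≠ 0 := by
    rwa [Ne, LinearEquiv.map_eq_zero_iff]
  obtain ⟨h, hh, h2⟩ := (hF.isNorm_tmul he).exists_sliceRight_ne_zero h1
  obtain ⟨g, hg, h3⟩ := (hE.isNorm_tmul he).exists_sliceRight_ne_zero h2
  have h4 : sliceRight _ g (sliceRight _ h ((TensorProduct.assoc ℂ (Lp ℂ p μ) E F).symm U)) =
      TensorProduct.rid ℂ _
        (amp (Lp ℂ p μ) (TensorProduct.lift ((LinearMap.mul ℂ ℂ).compl₁₂ g h)) U) := by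
    clear h1 h2 h3 hne hU h0
    induction U with
    | zero => simp
    | add U V hU hV => simp only [map_add, hU, hV]
    | tmul ξ t =>
      induction t with
      | zero => simp
      | add s t hs ht => simp only [TensorProduct.tmul_add, map_add, hs, ht]
      | tmul x y =>
        rw [TensorProduct.assoc_symm_tmul, sliceRight_tmul, map_smul, sliceRight_tmul, smul_smul,
          mul_comm]
        simp [amp]
  have hbd : ∀ u v, ‖TensorProduct.rid ℂ _
      (ampBilin dia ((LinearMap.mul ℂ ℂ).compl₁₂ g h) u v)‖ ≤ ‖dia‖ * (NE u * NF v) := by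
    intro u v
    rw [ampBilin_sliceRight]
    calc _ ≤ ‖dia‖ * ‖sliceRight _ g u‖ * ‖sliceRight _ h v‖ := dia.le_opNorm₂ _ _
      _ = ‖dia‖ * (‖sliceRight _ g u‖ * ‖sliceRight _ h v‖) := by ring
      _ ≤ ‖dia‖ * (NE u * NF v) := by
        gcongr
        · exact hE.isNorm.nonneg u
        · exact hE.norm_sliceRight_le he hg u
        · exact hF.norm_sliceRight_le he hh v
  have h5 := le_mul_pTensorNorm hne (norm_nonneg dia) fun r hr =>
    norm_amp_lift_le_of_mem_reprValues hp hE.isNorm hF.isNorm isLNorm_rid (isPConvex_rid hp)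
      (norm_nonneg dia) hbd hr
  rw [hU, mul_zero, ← h4] at h5
  exact h3 (norm_le_zero_iff.1 h5)

/-- The universal property of `E ⊗ F` follows once linearization does not increase bounds. -/
theorem exists_linearization {NΘ : Lp ℂ p μ ⊗[ℂ] (E ⊗[ℂ] F) → ℝ} (hE : ∀ u, 0 ≤ NE u)
    (hF : ∀ v, 0 ≤ NF v)
    (hθ : ∀ u v, NΘ (ampBilin dia (TensorProduct.mk ℂ E F) u v) ≤ NE u * NF v)
    {ρ : E →ₗ[ℂ] F →ₗ[ℂ] G}
    (hR : ∀ C : ℝ, 0 ≤ C → (∀ u v, NG (ampBilin dia ρ u v) ≤ C * (NE u * NF v)) →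
      ∀ U, NG (amp (Lp ℂ p μ) (TensorProduct.lift ρ) U) ≤ C * NΘ U)
    (hρ : IsBddBilin NE NF NG (ampBilin dia ρ)) :
    ∃ R : E ⊗[ℂ] F →ₗ[ℂ] G,
      IsBddMap NΘ NG (amp (Lp ℂ p μ) R) ∧
      (∀ x y, R (TensorProduct.mk ℂ E F x y) = ρ x y) ∧
      mapNorm NΘ NG (amp (Lp ℂ p μ) R) = bilinNorm NE NF NG (ampBilin dia ρ) ∧
      ∀ R' : E ⊗[ℂ] F →ₗ[ℂ] G, IsBddMap NΘ NG (amp (Lp ℂ p μ) R') →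
        (∀ x y, R' (TensorProduct.mk ℂ E F x y) = ρ x y) → R' = R := by
  refine ⟨TensorProduct.lift ρ, ?_, fun x y => rfl, ?_, fun R' _ hR' =>
    TensorProduct.ext' fun x y => hR' x y⟩
  · obtain ⟨C, hC⟩ := hρ
    exact ⟨|C|, hR |C| (abs_nonneg C) fun u v => (hC u v).trans
      (mul_le_mul_of_nonneg_right (le_abs_self C) (mul_nonneg (hE u) (hF v)))⟩
  · rw [mapNorm, bilinNorm]
    congr 1
    ext C
    refine ⟨fun ⟨hC, h⟩ => ⟨hC, fun u v => ?_⟩, fun ⟨hC, h⟩ => ⟨hC, hR C hC h⟩⟩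
    rw [← amp_ampBilin dia (R := TensorProduct.lift ρ) (θ := TensorProduct.mk ℂ E F)
      (fun x y => rfl)]
    exact (h _).trans (mul_le_mul_of_nonneg_left (hθ u v) hC)

end Estimate

/-! ### Merging representations over `L_p(ℕX)` -/

section Merge

variable {X : Type*} [MeasurableSpace X] {p : ℝ≥0∞} [Fact (1 ≤ p)] {μ : Measure X}
  {E F : Type*} [AddCommGroup E] [Module ℂ E] [AddCommGroup F] [Module ℂ F]
  {dia : Lp ℂ p (copies μ) →L[ℂ] Lp ℂ p (copies μ) →L[ℂ] Lp ℂ p (copies μ)}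
  {NE : Lp ℂ p (copies μ) ⊗[ℂ] E → ℝ} {NF : Lp ℂ p (copies μ) ⊗[ℂ] F → ℝ}

/-- The injections `n ↦ 2n` and `n ↦ 2n + 1` of `ℕ`. -/
def interleave (b : Bool) (n : ℕ) : ℕ := 2 * n + b.toNat

theorem interleave_injective (b : Bool) : Function.Injective (interleave b) := by
  intro m n h
  simp only [interleave] at h
  omega

omit [MeasurableSpace X] in
theorem disjoint_range_shiftMap_interleave :
    Pairwise fun b c => Disjoint (Set.range (shiftMap X (interleave b)))
      (Set.range (shiftMap X (interleave c))) := by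
  intro b c hbc
  rw [range_shiftMap, range_shiftMap, Set.disjoint_left]
  rintro ⟨k, x⟩ ⟨⟨m, hm⟩, -⟩ ⟨⟨n, hn⟩, -⟩
  refine hbc ?_
  cases b <;> cases c <;> simp [interleave] at hm hn ⊢ <;> omega

/-- The two isometries of `L_p(ℕX)` onto its even and its odd copies. -/
noncomputable def shiftIso (p : ℝ≥0∞) [Fact (1 ≤ p)] (μ : Measure X) (b : Bool) :
    Lp ℂ p (copies μ) →ₗᵢ[ℂ] Lp ℂ p (copies μ) :=
  extendLp p (measurableEmbedding_shiftMap (interleave_injective b))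
    (map_shiftMap (interleave_injective b))

/-- The left inverse of `shiftIso` which vanishes on the range of the other one. -/
noncomputable def shiftInv (p : ℝ≥0∞) [Fact (1 ≤ p)] (μ : Measure X) (b : Bool) :
    Lp ℂ p (copies μ) →L[ℂ] Lp ℂ p (copies μ) :=
  restrictLp p (measurableEmbedding_shiftMap (interleave_injective b))
    (map_shiftMap (interleave_injective b))

theorem shiftInv_shiftIso (b : Bool) (f : Lp ℂ p (copies μ)) :
    shiftInv p μ b (shiftIso p μ b f) = f :=
  restrictLp_extendLp _ _ f

theorem shiftInv_shiftIso_of_ne {b c : Bool} (h : b ≠ c) (f : Lp ℂ p (copies μ)) :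
    shiftInv p μ b (shiftIso p μ c f) = 0 :=
  restrictLp_extendLp_eq_zero _ _ _ _ (disjoint_range_shiftMap_interleave h) f

theorem norm_shiftInv_rpow_add_le (hp : p ≠ ∞) (f : Lp ℂ p (copies μ)) :
    ‖shiftInv p μ true f‖ ^ p.toReal + ‖shiftInv p μ false f‖ ^ p.toReal ≤ ‖f‖ ^ p.toReal := by
  have h := sum_norm_properProj_rpow_le hp Finset.univ
    (fun b => Set.range (shiftMap X (interleave b)))
    (fun b => (measurableEmbedding_shiftMap (interleave_injective b)).measurableSet_range)
    disjoint_range_shiftMap_interleave f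
  rw [Fintype.sum_bool, ← extendLp_restrictLp (measurableEmbedding_shiftMap
    (interleave_injective true)) (map_shiftMap (interleave_injective true)),
    ← extendLp_restrictLp (measurableEmbedding_shiftMap
    (interleave_injective false)) (map_shiftMap (interleave_injective false)),
    LinearIsometry.norm_map, LinearIsometry.norm_map] at h
  exact h

theorem range_shiftIso_comp_inter {b c : Bool} (h : b ≠ c)
    (I I' : Lp ℂ p (copies μ) →ₗᵢ[ℂ] Lp ℂ p (copies μ)) :
    Set.range ((shiftIso p μ b).comp I) ∩ Set.range ((shiftIso p μ c).comp I') = {0} := by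
  ext f
  constructor
  · rintro ⟨⟨g, rfl⟩, ⟨g', hg'⟩⟩
    have h1 := shiftInv_shiftIso b (I g)
    change shiftIso p μ c (I' g') = shiftIso p μ b (I g) at hg'
    rw [← hg', shiftInv_shiftIso_of_ne h] at h1
    change shiftIso p μ b (I g) = 0
    rw [← h1, map_zero]
  · rintro rfl
    exact ⟨⟨0, map_zero _⟩, ⟨0, map_zero _⟩⟩

theorem DisjointSum.shift_add {A B : ℝ} {W W' : Lp ℂ p (copies μ) ⊗[ℂ] (E ⊗[ℂ] F)}
    (hA : DisjointSum dia NE NF A W) (hB : DisjointSum dia NE NF B W') :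
    DisjointSum dia NE NF (A + B) (act (shiftIso p μ true).toContinuousLinearMap W +
      act (shiftIso p μ false).toContinuousLinearMap W') := by
  obtain ⟨n, I, u, v, hI, hd, rfl, rfl⟩ := hA
  obtain ⟨n', I', u', v', hI', hd', rfl, rfl⟩ := hB
  have hinter : ∀ (b : Bool) (I I' : Lp ℂ p (copies μ) →ₗᵢ[ℂ] Lp ℂ p (copies μ)),
      Set.range I ∩ Set.range I' = {0} →
      Set.range ((shiftIso p μ b).comp I) ∩ Set.range ((shiftIso p μ b).comp I') = {0} := by
    intro b I I' h
    rw [LinearIsometry.coe_comp, LinearIsometry.coe_comp, Set.range_comp, Set.range_comp,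
      ← Set.image_inter (shiftIso p μ b).injective, h, Set.image_singleton, map_zero]
  refine ⟨n + n', Fin.append (fun k => (shiftIso p μ true).comp (I k))
    (fun k => (shiftIso p μ false).comp (I' k)), Fin.append u u', Fin.append v v', ?_, ?_, ?_, ?_⟩
  · refine Fin.addCases (fun k => ?_) (fun k => ?_)
    · rw [Fin.append_left]
      exact (hI k).extendLp_comp _ _
    · rw [Fin.append_right]
      exact (hI' k).extendLp_comp _ _
  · refine Fin.addCases (fun j => Fin.addCases (fun k hjk => ?_) (fun k hjk => ?_))
      (fun j => Fin.addCases (fun k hjk => ?_) (fun k hjk => ?_))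
    · rw [Fin.append_left, Fin.append_left]
      exact hinter _ _ _ (hd j k fun h => hjk (h ▸ rfl))
    · rw [Fin.append_left, Fin.append_right]
      exact range_shiftIso_comp_inter (by simp) _ _
    · rw [Fin.append_left, Fin.append_right]
      exact range_shiftIso_comp_inter (by simp) _ _
    · rw [Fin.append_right, Fin.append_right]
      exact hinter _ _ _ (hd' j k fun h => hjk (h ▸ rfl))
  · rw [Fin.sum_univ_add, map_sum, map_sum]
    simp only [Fin.append_left, Fin.append_right, act_act]
    rfl
  · rw [Fin.sum_univ_add]
    simp only [Fin.append_left, Fin.append_right]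

/-- Two representations are merged by moving their disjoint sums to the even and to the odd copies
of `X`; the norm of the new outer factor is controlled by that of the pair `(a, b)` as an operator
on the `ℓ_p`-sum of two copies of `L_p(ℕX)`. -/
theorem exists_merge (hp : p ≠ ∞) {A B : ℝ} {W W' : Lp ℂ p (copies μ) ⊗[ℂ] (E ⊗[ℂ] F)}
    (hA : DisjointSum dia NE NF A W) (hB : DisjointSum dia NE NF B W')
    (a b : Lp ℂ p (copies μ) →L[ℂ] Lp ℂ p (copies μ)) :
    ∃ (c : Lp ℂ p (copies μ) →L[ℂ] Lp ℂ p (copies μ)) (V : Lp ℂ p (copies μ) ⊗[ℂ] (E ⊗[ℂ] F)),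
      DisjointSum dia NE NF (A + B) V ∧ act a W + act b W' = act c V ∧
      ∀ γ : ℝ, 0 ≤ γ → (∀ ξ η, ‖a ξ + b η‖ ≤
        γ * (‖ξ‖ ^ p.toReal + ‖η‖ ^ p.toReal) ^ (1 / p.toReal)) → ‖c‖ ≤ γ := by
  refine ⟨a ∘L shiftInv p μ true + b ∘L shiftInv p μ false, _, hA.shift_add hB, ?_, ?_⟩
  · have h1 : (a ∘L shiftInv p μ true + b ∘L shiftInv p μ false) ∘L
        (shiftIso p μ true).toContinuousLinearMap = a := by
      refine ContinuousLinearMap.ext fun f => ?_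
      change a (shiftInv p μ true (shiftIso p μ true f)) +
        b (shiftInv p μ false (shiftIso p μ true f)) = a f
      rw [shiftInv_shiftIso, shiftInv_shiftIso_of_ne (by simp), map_zero, add_zero]
    have h2 : (a ∘L shiftInv p μ true + b ∘L shiftInv p μ false) ∘L
        (shiftIso p μ false).toContinuousLinearMap = b := by
      refine ContinuousLinearMap.ext fun f => ?_
      change a (shiftInv p μ true (shiftIso p μ false f)) +
        b (shiftInv p μ false (shiftIso p μ false f)) = b f
      rw [shiftInv_shiftIso, shiftInv_shiftIso_of_ne (by simp), map_zero, zero_add]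
    rw [map_add, act_act, act_act, h1, h2]
  · intro γ hγ h
    refine ContinuousLinearMap.opNorm_le_bound _ hγ fun f => (h _ _).trans ?_
    refine mul_le_mul_of_nonneg_left ?_ hγ
    calc _ ≤ (‖f‖ ^ p.toReal) ^ (1 / p.toReal) := Real.rpow_le_rpow (by positivity)
          (norm_shiftInv_rpow_add_le hp f) (by simp)
      _ = ‖f‖ := rpow_rpow_one_div (norm_nonneg f) (toReal_pos' hp)

theorem reprValues_nonempty_of_eq {A : ℝ} {U W : Lp ℂ p (copies μ) ⊗[ℂ] (E ⊗[ℂ] F)}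
    (a : Lp ℂ p (copies μ) →L[ℂ] Lp ℂ p (copies μ))
    (hW : DisjointSum dia NE NF A W) (hU : U = act a W) : (reprValues dia NE NF U).Nonempty :=
  ⟨_, mem_reprValues_iff.2 ⟨a, A, W, hW, hU, rfl⟩⟩

theorem reprValues_nonempty_add (hp : p ≠ ∞) {U V : Lp ℂ p (copies μ) ⊗[ℂ] (E ⊗[ℂ] F)}
    (hU : (reprValues dia NE NF U).Nonempty) (hV : (reprValues dia NE NF V).Nonempty) :
    (reprValues dia NE NF (U + V)).Nonempty := by
  obtain ⟨r, hr⟩ := hU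
  obtain ⟨s, hs⟩ := hV
  obtain ⟨a, A, W, hA, rfl, -⟩ := mem_reprValues_iff.1 hr
  obtain ⟨b, B, W', hB, rfl, -⟩ := mem_reprValues_iff.1 hs
  obtain ⟨c, V, hV, h, -⟩ := exists_merge hp hA hB a b
  exact reprValues_nonempty_of_eq c hV h

theorem reprValues_nonempty (hp : p ≠ ∞) (hdia : dia ≠ 0)
    (U : Lp ℂ p (copies μ) ⊗[ℂ] (E ⊗[ℂ] F)) : (reprValues dia NE NF U).Nonempty := by
  obtain ⟨ξ, η, hξη⟩ : ∃ ξ η, dia ξ η ≠ 0 := by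
    by_contra! h
    exact hdia (ContinuousLinearMap.ext fun ξ => ContinuousLinearMap.ext fun η => h ξ η)
  obtain ⟨f, -, hf⟩ := exists_dual_vector ℂ _ (norm_ne_zero_iff.2 hξη)
  have hf0 : f (dia ξ η) ≠ 0 := by
    rw [hf]
    simpa using hξη
  have hzero : (reprValues dia NE NF 0).Nonempty :=
    reprValues_nonempty_of_eq 0 disjointSum_zero (by simp)
  induction U with
  | zero => exact hzero
  | add U V hU hV => exact reprValues_nonempty_add hp hU hV
  | tmul ζ t =>
    induction t with
    | zero => simpa using hzero
    | add s t hs ht =>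
      rw [TensorProduct.tmul_add]
      exact reprValues_nonempty_add hp hs ht
    | tmul x y =>
      refine reprValues_nonempty_of_eq (f.smulRight ((f (dia ξ η))⁻¹ • ζ))
        (disjointSum_ampBilin (ξ ⊗ₜ x) (η ⊗ₜ y)) ?_
      rw [ampBilin_tmul, act_tmul, ContinuousLinearMap.smulRight_apply, smul_smul,
        mul_inv_cancel₀ hf0, one_smul]
      rfl

theorem exists_scaling {x y α β : ℝ} (hx : 0 ≤ x) (hy : 0 ≤ y) (hα : 0 < α) (hβ : 0 < β)
    (h : x * y < α * β) : ∃ t : ℝ, 0 < t ∧ t * x ≤ α ∧ t⁻¹ * y ≤ β := by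
  rcases hx.eq_or_lt with rfl | hx
  · refine ⟨y / β + 1, by positivity, by simpa using hα.le, ?_⟩
    rw [inv_mul_le_iff₀ (by positivity), add_mul, div_mul_cancel₀ _ hβ.ne']
    linarith
  · refine ⟨α / x, by positivity, (div_mul_cancel₀ _ hx.ne').le, ?_⟩
    rw [inv_div, div_mul_eq_mul_div, div_le_iff₀ hα, mul_comm β]
    exact h.le

/-- Near-optimal representations can be normalized so that the norm of the outer factor and the
sum of `p`-th powers have any prescribed bounds with the right product. -/
theorem exists_repr_of_pTensorNorm_lt (hp : p ≠ ∞) (hdia : dia ≠ 0) (hE : IsNorm NE)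
    (hF : IsNorm NF) {U : Lp ℂ p (copies μ) ⊗[ℂ] (E ⊗[ℂ] F)} {α β : ℝ} (hα : 0 < α) (hβ : 0 < β)
    (hU : pTensorNorm dia NE NF U < α * β) :
    ∃ (a : Lp ℂ p (copies μ) →L[ℂ] Lp ℂ p (copies μ)) (A : ℝ)
      (W : Lp ℂ p (copies μ) ⊗[ℂ] (E ⊗[ℂ] F)),
      DisjointSum dia NE NF A W ∧ U = act a W ∧ ‖a‖ ≤ α ∧ A ≤ β ^ p.toReal := by
  have hq := toReal_pos' hp
  obtain ⟨r, hr, hlt⟩ := exists_lt_of_csInf_lt (reprValues_nonempty hp hdia U) hU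
  obtain ⟨a, A, W, hA, rfl, rfl⟩ := mem_reprValues_iff.1 hr
  have hA0 := hA.nonneg hE hF
  obtain ⟨t, ht, h1, h2⟩ :=
    exists_scaling (norm_nonneg a) (Real.rpow_nonneg hA0 (1 / p.toReal)) hα hβ hlt
  have ht' : (t : ℂ) ≠ 0 := by exact_mod_cast ht.ne'
  refine ⟨(t : ℂ) • a, _, _, hA.smul hE ((t : ℂ)⁻¹), ?_, ?_, ?_⟩
  · rw [act_smul, map_smul, smul_smul, mul_inv_cancel₀ ht', one_smul]
  · refine (ContinuousLinearMap.opNorm_smul_le _ _).trans ?_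
    rwa [Complex.norm_real, Real.norm_of_nonneg ht.le]
  · have h3 := Real.rpow_le_rpow
      (mul_nonneg (inv_nonneg.2 ht.le) (Real.rpow_nonneg hA0 (1 / p.toReal))) h2 hq.le
    rw [Real.mul_rpow (inv_nonneg.2 ht.le) (Real.rpow_nonneg hA0 _), rpow_one_div_rpow hA0 hq] at h3
    rwa [norm_inv, Complex.norm_real, Real.norm_of_nonneg ht.le]

theorem pTensorNorm_add_le_of_repr (hp : p ≠ ∞) (hE : IsNorm NE) (hF : IsNorm NF)
    {W W' : Lp ℂ p (copies μ) ⊗[ℂ] (E ⊗[ℂ] F)} {A B s t γ : ℝ}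
    (hA : DisjointSum dia NE NF A W) (hB : DisjointSum dia NE NF B W') (hAs : A ≤ s) (hBt : B ≤ t)
    (a b : Lp ℂ p (copies μ) →L[ℂ] Lp ℂ p (copies μ)) (hγ : 0 ≤ γ)
    (hab : ∀ ξ η, ‖a ξ + b η‖ ≤ γ * (‖ξ‖ ^ p.toReal + ‖η‖ ^ p.toReal) ^ (1 / p.toReal)) :
    pTensorNorm dia NE NF (act a W + act b W') ≤ γ * (s + t) ^ (1 / p.toReal) := by
  obtain ⟨c, V, hV, h, hc⟩ := exists_merge hp hA hB a b
  have h0 := hV.nonneg hE hF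
  refine (pTensorNorm_le_of_mem hE hF (mem_reprValues_iff.2 ⟨c, _, V, hV, h, rfl⟩)).trans ?_
  refine mul_le_mul (hc γ hγ hab) ?_ (Real.rpow_nonneg h0 _) hγ
  exact Real.rpow_le_rpow h0 (add_le_add hAs hBt) (by simp)

theorem holder_two {q r s x y : ℝ} (hq : 1 ≤ q) (hr : 0 < r) (hs : 0 < s) (hx : 0 ≤ x)
    (hy : 0 ≤ y) : r ^ (1 - 1 / q) * x + s ^ (1 - 1 / q) * y ≤
      (r + s) ^ (1 - 1 / q) * (x ^ q + y ^ q) ^ (1 / q) := by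
  rcases hq.eq_or_lt with rfl | hq
  · simp
  have hc : q.conjExponent.HolderConjugate q := (Real.HolderConjugate.conjExponent hq).symm
  have h0 : 1 - 1 / q = 1 / q.conjExponent := by
    have := hc.inv_add_inv_eq_one
    rw [one_div, one_div]
    linarith
  have h := Real.inner_le_Lp_mul_Lq_of_nonneg Finset.univ hc
    (f := fun b : Bool => cond b (r ^ (1 / q.conjExponent)) (s ^ (1 / q.conjExponent)))
    (g := fun b : Bool => cond b x y)
    (by rintro (_ | _) _ <;> simp <;> positivity) (by rintro (_ | _) _ <;> simpa)
  simp only [Fintype.sum_bool, cond_true, cond_false] at h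
  rw [rpow_one_div_rpow hr.le hc.pos, rpow_one_div_rpow hs.le hc.pos] at h
  rwa [h0]

theorem pTensorNorm_act_le (hp : p ≠ ∞) (hdia : dia ≠ 0) (hE : IsNorm NE) (hF : IsNorm NF)
    (b : Lp ℂ p (copies μ) →L[ℂ] Lp ℂ p (copies μ)) (U : Lp ℂ p (copies μ) ⊗[ℂ] (E ⊗[ℂ] F)) :
    pTensorNorm dia NE NF (act b U) ≤ ‖b‖ * pTensorNorm dia NE NF U := by
  refine le_mul_pTensorNorm (reprValues_nonempty hp hdia U) (norm_nonneg b) fun r hr => ?_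
  obtain ⟨a, A, W, hA, rfl, rfl⟩ := mem_reprValues_iff.1 hr
  refine (pTensorNorm_le_of_mem hE hF (mem_reprValues_iff.2
    ⟨b ∘L a, A, W, hA, act_act _ _ _, rfl⟩)).trans ?_
  rw [← mul_assoc]
  exact mul_le_mul_of_nonneg_right (b.opNorm_comp_le a) (Real.rpow_nonneg (hA.nonneg hE hF) _)

theorem pTensorNorm_add_le (hp : p ≠ ∞) (hdia : dia ≠ 0) (hE : IsNorm NE) (hF : IsNorm NF)
    (U V : Lp ℂ p (copies μ) ⊗[ℂ] (E ⊗[ℂ] F)) :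
    pTensorNorm dia NE NF (U + V) ≤ pTensorNorm dia NE NF U + pTensorNorm dia NE NF V := by
  have hq := toReal_pos' hp
  refine le_of_forall_pos_le_add fun ε hε => ?_
  set r := pTensorNorm dia NE NF U + ε / 2 with hr
  set s := pTensorNorm dia NE NF V + ε / 2 with hs
  have hr0 : 0 < r := by
    have := pTensorNorm_nonneg (dia := dia) hE hF U
    linarith
  have hs0 : 0 < s := by
    have := pTensorNorm_nonneg (dia := dia) hE hF V
    linarith
  -- the outer factors get the weights `r ^ (1 - 1 / p)` and the sums the weights `r`
  have hsplit : ∀ x : ℝ, 0 < x → x ^ (1 - 1 / p.toReal) * x ^ (1 / p.toReal) = x := by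
    intro x hx
    rw [← Real.rpow_add hx, sub_add_cancel, Real.rpow_one]
  obtain ⟨a, A, W, hA, hU, ha, hAr⟩ := exists_repr_of_pTensorNorm_lt hp hdia hE hF
    (U := U) (Real.rpow_pos_of_pos hr0 (1 - 1 / p.toReal)) (Real.rpow_pos_of_pos hr0 (1 / p.toReal))
    (by rw [hsplit r hr0]; linarith)
  obtain ⟨b, B, W', hB, hV, hb, hBs⟩ := exists_repr_of_pTensorNorm_lt hp hdia hE hF
    (U := V) (Real.rpow_pos_of_pos hs0 (1 - 1 / p.toReal)) (Real.rpow_pos_of_pos hs0 (1 / p.toReal))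
    (by rw [hsplit s hs0]; linarith)
  rw [rpow_one_div_rpow hr0.le hq] at hAr
  rw [rpow_one_div_rpow hs0.le hq] at hBs
  rw [hU, hV]
  refine (pTensorNorm_add_le_of_repr hp hE hF hA hB hAr hBs a b
    (γ := (r + s) ^ (1 - 1 / p.toReal)) (by positivity) fun ξ η => ?_).trans ?_
  · refine le_trans ?_ (holder_two (one_le_toReal hp) hr0 hs0 (norm_nonneg ξ) (norm_nonneg η))
    refine (norm_add_le _ _).trans (add_le_add ?_ ?_)
    · exact (a.le_opNorm ξ).trans (mul_le_mul_of_nonneg_right ha (norm_nonneg ξ))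
    · exact (b.le_opNorm η).trans (mul_le_mul_of_nonneg_right hb (norm_nonneg η))
  · rw [hsplit (r + s) (add_pos hr0 hs0), ← hU, ← hV]
    linarith

theorem isPConvex_pTensorNorm (hp : p ≠ ∞) (hdia : dia ≠ 0) (hE : IsNorm NE) (hF : IsNorm NF) :
    IsPConvex (pTensorNorm dia NE NF) := by
  intro Y Z hY hZ hYZ _ U V hU hV
  have hq := toReal_pos' hp
  have hU0 := pTensorNorm_nonneg (dia := dia) hE hF U
  have hV0 := pTensorNorm_nonneg (dia := dia) hE hF V
  have key : ∀ ε : ℝ, 0 < ε → pTensorNorm dia NE NF (U + V) ≤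
      ((pTensorNorm dia NE NF U + ε) ^ p.toReal + (pTensorNorm dia NE NF V + ε) ^ p.toReal) ^
        (1 / p.toReal) := by
    intro ε hε
    obtain ⟨a, A, W, hA, hUa, ha, hAr⟩ := exists_repr_of_pTensorNorm_lt hp hdia hE hF
      (U := U) one_pos (add_pos_of_nonneg_of_pos hU0 hε) (by linarith)
    obtain ⟨b, B, W', hB, hVb, hb, hBs⟩ := exists_repr_of_pTensorNorm_lt hp hdia hE hF
      (U := V) one_pos (add_pos_of_nonneg_of_pos hV0 hε) (by linarith)
    have h1 : U + V = act (properProj p _ Y hY ∘L a) W + act (properProj p _ Z hZ ∘L b) W' := by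
      rw [← act_act, ← act_act, ← hUa, ← hVb, hU, hV]
    rw [h1]
    refine (pTensorNorm_add_le_of_repr hp hE hF hA hB hAr hBs _ _ zero_le_one
      fun ξ η => ?_).trans (one_mul _).le
    have h2 : DisjointSupp (properProj p _ Y hY (a ξ)) (properProj p _ Z hZ (b η)) :=
      disjointSupp_of_properProj hY hZ (fun f => by
        rw [← ContinuousLinearMap.comp_apply, hYZ]
        rfl) (properProj_idem hY _) (properProj_idem hZ _)
    have h3 : ∀ (Y : Set (ℕ × X)) (hY : MeasurableSet Y)
        (c : Lp ℂ p (copies μ) →L[ℂ] Lp ℂ p (copies μ)) (ζ : Lp ℂ p (copies μ)), ‖c‖ ≤ 1 →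
        ‖properProj p _ Y hY (c ζ)‖ ≤ ‖ζ‖ := fun Y hY c ζ hc =>
      ((properProj p _ Y hY).le_of_opNorm_le (norm_properProj_le hY) _).trans
        (by rw [one_mul]; exact (c.le_of_opNorm_le hc ζ).trans (one_mul _).le)
    rw [one_mul, ContinuousLinearMap.comp_apply, ContinuousLinearMap.comp_apply,
      ← rpow_rpow_one_div (norm_nonneg (_ + _)) hq, h2.norm_add_rpow hp]
    refine Real.rpow_le_rpow (by positivity) (add_le_add ?_ ?_) (by simp)
    · exact Real.rpow_le_rpow (norm_nonneg _) (h3 Y hY a ξ ha) hq.le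
    · exact Real.rpow_le_rpow (norm_nonneg _) (h3 Z hZ b η hb) hq.le
  have hcont : Continuous fun ε : ℝ => ((pTensorNorm dia NE NF U + ε) ^ p.toReal +
      (pTensorNorm dia NE NF V + ε) ^ p.toReal) ^ (1 / p.toReal) := by
    refine Continuous.rpow_const (Continuous.add (Continuous.rpow_const (by fun_prop) ?_)
      (Continuous.rpow_const (by fun_prop) ?_)) ?_
    · exact fun _ => Or.inr hq.le
    · exact fun _ => Or.inr hq.le
    · exact fun _ => Or.inr (by simp)
  have hlim := (hcont.tendsto 0).mono_left (nhdsWithin_le_nhds (s := Set.Ioi 0))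
  simp only [add_zero] at hlim
  refine ge_of_tendsto hlim ?_
  filter_upwards [self_mem_nhdsWithin] with ε hε using key ε hε

theorem isLNorm_pTensorNorm (hp : p ≠ ∞) (hdia : dia ≠ 0) {e : Lp ℂ p (copies μ)} (he : ‖e‖ = 1)
    (hE : IsNearLNorm NE) (hF : IsNearLNorm NF) : IsLNorm (pTensorNorm dia NE NF) where
  isNorm :=
    { nonneg := pTensorNorm_nonneg hE.isNorm hF.isNorm
      add_le := pTensorNorm_add_le hp hdia hE.isNorm hF.isNorm
      smul := by
        have hle : ∀ (c : ℂ) (U : Lp ℂ p (copies μ) ⊗[ℂ] (E ⊗[ℂ] F)),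
            pTensorNorm dia NE NF (c • U) ≤ ‖c‖ * pTensorNorm dia NE NF U := by
          intro c U
          have h := pTensorNorm_act_le hp hdia hE.isNorm hF.isNorm
            (c • ContinuousLinearMap.id ℂ _) U
          rw [act_smul, act_id] at h
          refine h.trans (mul_le_mul_of_nonneg_right ?_ (pTensorNorm_nonneg hE.isNorm hF.isNorm U))
          exact (ContinuousLinearMap.opNorm_smul_le _ _).trans
            (mul_le_of_le_one_right (norm_nonneg c) ContinuousLinearMap.norm_id_le)
        intro c U
        refine le_antisymm (hle c U) ?_
        rcases eq_or_ne c 0 with rfl | hc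
        · rw [norm_zero, zero_mul]
          exact pTensorNorm_nonneg hE.isNorm hF.isNorm _
        · have h := hle c⁻¹ (c • U)
          rw [smul_smul, inv_mul_cancel₀ hc, one_smul, norm_inv,
            le_inv_mul_iff₀ (norm_pos_iff.2 hc)] at h
          exact h
      eq_zero := fun U hU =>
        eq_zero_of_pTensorNorm_eq_zero hp he hE hF (reprValues_nonempty hp hdia U) hU }
  act_le := pTensorNorm_act_le hp hdia hE.isNorm hF.isNorm

end Merge

/-! ### Systems of disjointly supported unit vectors -/

section Systems

variable {X : Type*} [MeasurableSpace X] {p : ℝ≥0∞} [Fact (1 ≤ p)] {μ : Measure X}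

/-- The unit vectors `e i` of `L_p(X)` are supported by the pairwise disjoint sets `Y i`. -/
structure IsDisjointSystem {ι : Type*} (e : ι → Lp ℂ p μ) (Y : ι → Set X) : Prop where
  measurableSet : ∀ i, MeasurableSet (Y i)
  disjoint : Pairwise fun i j => Disjoint (Y i) (Y j)
  norm_eq_one : ∀ i, ‖e i‖ = 1
  properProj_eq : ∀ i, properProj p μ (Y i) (measurableSet i) (e i) = e i

namespace IsDisjointSystem

variable {ι κ : Type*} {e : ι → Lp ℂ p μ} {Y : ι → Set X}

theorem comp_injective (h : IsDisjointSystem e Y) {σ : κ → ι} (hσ : Function.Injective σ) :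
    IsDisjointSystem (e ∘ σ) (Y ∘ σ) :=
  ⟨fun _ => h.measurableSet _, fun _ _ hij => h.disjoint (hσ.ne hij), fun _ => h.norm_eq_one _,
    fun _ => h.properProj_eq _⟩

/-- Functionals biorthogonal to a disjoint system; each is dominated by the norm of the restriction
to the corresponding set. -/
theorem exists_biorthogonal [DecidableEq ι] (h : IsDisjointSystem e Y) :
    ∃ φ : ι → Lp ℂ p μ →L[ℂ] ℂ,
      (∀ i f, ‖φ i f‖ ≤ ‖properProj p μ (Y i) (h.measurableSet i) f‖) ∧
      ∀ i j, φ i (e j) = if i = j then 1 else 0 := by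
  choose ψ hψ1 hψ using fun i => exists_dual_vector'' ℂ (e i)
  refine ⟨fun i => ψ i ∘L properProj p μ (Y i) (h.measurableSet i), fun i f => ?_, fun i j => ?_⟩
  · exact ((ψ i).le_of_opNorm_le (hψ1 i) _).trans (one_mul _).le
  · rw [ContinuousLinearMap.comp_apply]
    by_cases hij : i = j
    · subst hij
      rw [if_pos rfl, h.properProj_eq, hψ, h.norm_eq_one]
      simp
    · rw [if_neg hij, ← h.properProj_eq j, properProj_eq_zero_of_disjoint _ _ (h.disjoint hij),
        map_zero]

theorem sum_norm_biorthogonal_rpow_le (hp : p ≠ ∞) [Fintype ι] (h : IsDisjointSystem e Y)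
    {φ : ι → Lp ℂ p μ →L[ℂ] ℂ}
    (hφ : ∀ i f, ‖φ i f‖ ≤ ‖properProj p μ (Y i) (h.measurableSet i) f‖) (f : Lp ℂ p μ) :
    ∑ i, ‖φ i f‖ ^ p.toReal ≤ ‖f‖ ^ p.toReal :=
  (Finset.sum_le_sum fun i _ => Real.rpow_le_rpow (norm_nonneg _) (hφ i f)
    (toReal_pos' hp).le).trans
    (sum_norm_properProj_rpow_le hp Finset.univ Y h.measurableSet h.disjoint f)

theorem norm_sum_smul_rpow (hp : p ≠ ∞) [Fintype ι] (h : IsDisjointSystem e Y) (c : ι → ℂ) :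
    ‖∑ i, c i • e i‖ ^ p.toReal = ∑ i, ‖c i‖ ^ p.toReal := by
  rw [norm_sum_rpow_of_disjointSupp hp]
  · simp_rw [norm_smul, h.norm_eq_one, mul_one]
  · intro i _ j _ hij
    refine disjointSupp_of_properProj (h.measurableSet i) (h.measurableSet j)
      (properProj_eq_zero_of_disjoint _ _ (h.disjoint hij)) ?_ ?_
    · rw [map_smul, h.properProj_eq]
    · rw [map_smul, h.properProj_eq]

end IsDisjointSystem

/-- Approximation of finitely many functions at once: take a simple function close to the vector
function with these coordinates; its level sets carry the disjoint system. -/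
theorem exists_disjointSystem_approx (hp : p ≠ ∞) {ι : Type} [Fintype ι] (ξ : ι → Lp ℂ p μ)
    {ε : ℝ} (hε : 0 < ε) :
    ∃ (m : ℕ) (e : Fin m → Lp ℂ p μ) (Y : Fin m → Set X), IsDisjointSystem e Y ∧
      ∃ ξ' : ι → Lp ℂ p μ, (∀ i, ξ' i ∈ Submodule.span ℂ (Set.range e)) ∧
        ∀ i, ‖ξ i - ξ' i‖ < ε := by
  classical
  have hp0 : p ≠ 0 := (zero_lt_one.trans_le (Fact.out : 1 ≤ p)).ne'
  have hf : MemLp (fun x i => ξ i x : X → ι → ℂ) p μ := MemLp.of_eval fun i => Lp.memLp (ξ i)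
  obtain ⟨g, hg, hgm⟩ := hf.exists_simpleFunc_eLpNorm_sub_lt hp
    (ε := ENNReal.ofReal ε) (by simpa using hε)
  let κ := {y : ι → ℂ // y ∈ g.range ∧ y ≠ 0 ∧ μ (g ⁻¹' {y}) ≠ 0}
  have hfin : Finite κ := (g.range.finite_toSet.subset fun y hy => hy.1).to_subtype
  have := Fintype.ofFinite κ
  have hfinite : ∀ y : κ, μ (g ⁻¹' {y.1}) ≠ ∞ := fun y =>
    (g.measure_preimage_lt_top_of_memLp hp0 hp hgm y.1 y.2.2.1).ne
  let χ : κ → Lp ℂ p μ := fun y =>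
    indicatorConstLp p (g.measurableSet_fiber y.1) (hfinite y) (1 : ℂ)
  have hχ0 : ∀ y, ‖χ y‖ ≠ 0 := by
    intro y
    rw [norm_indicatorConstLp hp0 hp]
    have : 0 < μ.real (g ⁻¹' {y.1}) := ENNReal.toReal_pos y.2.2.2 (hfinite y)
    exact (mul_pos (by simp) (Real.rpow_pos_of_pos this _)).ne'
  have hsys : IsDisjointSystem (fun y : κ => ((‖χ y‖⁻¹ : ℝ) : ℂ) • χ y)
      (fun y : κ => g ⁻¹' {y.1}) := by
    refine ⟨fun y => g.measurableSet_fiber y.1, fun y z hyz => ?_, fun y => ?_, fun y => ?_⟩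
    · exact Disjoint.preimage _ (Set.disjoint_singleton.2 fun h => hyz (Subtype.ext h))
    · rw [norm_smul, Complex.norm_real, norm_inv, norm_norm, inv_mul_cancel₀ (hχ0 y)]
    · rw [map_smul]
      congr 1
      rw [properProj_eq_self_iff]
      filter_upwards [indicatorConstLp_coeFn (p := p) (hs := g.measurableSet_fiber y.1)
        (hμs := hfinite y) (c := (1 : ℂ))] with x hx hxy
      rw [hx, Set.indicator_of_notMem hxy]
  let σ : Fin (Fintype.card κ) ≃ κ := (Fintype.equivFin κ).symm
  refine ⟨_, _, _, hsys.comp_injective σ.injective, fun i => ∑ y : κ, y.1 i • χ y, fun i => ?_,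
    fun i => ?_⟩
  · refine Submodule.sum_mem _ fun y _ => Submodule.smul_mem _ _ ?_
    have h1 : χ y = ((‖χ y‖ : ℝ) : ℂ) • ((‖χ y‖⁻¹ : ℝ) : ℂ) • χ y := by
      rw [smul_smul, ← Complex.ofReal_mul, mul_inv_cancel₀ (hχ0 y), Complex.ofReal_one, one_smul]
    rw [h1]
    exact Submodule.smul_mem _ _ (Submodule.subset_span ⟨σ.symm y, by simp⟩)
  · have hnull : ∀ᵐ x ∂μ, ∀ y ∈ g.range, μ (g ⁻¹' {y}) = 0 → g x ≠ y := by
      rw [Finset.eventually_all]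
      intro y _
      by_cases hy : μ (g ⁻¹' {y}) = 0
      · filter_upwards [measure_eq_zero_iff_ae_notMem.1 hy] with x hx _ using hx
      · exact Filter.Eventually.of_forall fun x h => (hy h).elim
    have hχae : ∀ᵐ x ∂μ, ∀ y : κ, (y.1 i • χ y) x =
        y.1 i * (g ⁻¹' {y.1}).indicator (fun _ => (1 : ℂ)) x := by
      rw [Filter.eventually_all]
      intro y
      filter_upwards [Lp.coeFn_smul (y.1 i) (χ y), indicatorConstLp_coeFn (p := p)
        (hs := g.measurableSet_fiber y.1) (hμs := hfinite y) (c := (1 : ℂ))] with x h1 h2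
      rw [h1, Pi.smul_apply, smul_eq_mul, h2]
    have hae : (ξ i - ∑ y : κ, y.1 i • χ y : Lp ℂ p μ) =ᵐ[μ] fun x => ξ i x - g x i := by
      filter_upwards [Lp.coeFn_sub (ξ i) (∑ y : κ, y.1 i • χ y),
        Lp.coeFn_finsetSum Finset.univ (fun y : κ => y.1 i • χ y), hnull, hχae] with x h1 h2 h3 h4
      rw [h1, Pi.sub_apply, h2, Finset.sum_apply]
      congr 1
      simp_rw [h4]
      by_cases h0 : g x = 0
      · rw [h0, Pi.zero_apply]
        refine Finset.sum_eq_zero fun y _ => ?_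
        rw [Set.indicator_of_notMem, mul_zero]
        exact fun hx => y.2.2.1 (by rw [← show g x = y.1 from hx, h0])
      · have hmem : g x ∈ g.range := g.mem_range_self x
        rw [Finset.sum_eq_single (⟨g x, hmem, h0, fun h => h3 _ hmem h rfl⟩ : κ)]
        · simp
        · intro y _ hy
          rw [Set.indicator_of_notMem, mul_zero]
          exact fun hx => hy (Subtype.ext (show g x = y.1 from hx).symm)
        · exact fun h => (h (Finset.mem_univ _)).elim
    have hlt : eLpNorm (ξ i - ∑ y : κ, y.1 i • χ y : Lp ℂ p μ) p μ < ENNReal.ofReal ε := by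
      rw [eLpNorm_congr_ae hae]
      refine lt_of_le_of_lt (eLpNorm_mono fun x => ?_) hg
      exact norm_le_pi_norm ((fun j => ξ j x) - g x) i
    rw [Lp.norm_def]
    exact (ENNReal.lt_ofReal_iff_toReal_lt (Lp.eLpNorm_ne_top _)).1 hlt

/-- In an infinite-dimensional `L_p(X)` there are arbitrarily long disjoint systems: a small
perturbation of a linearly independent family remains linearly independent, and it can be chosen in
the span of a disjoint system. -/
theorem exists_disjointSystem (hp : p ≠ ∞) (hL : ¬ FiniteDimensional ℂ (Lp ℂ p μ)) (M : ℕ) :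
    ∃ (e : Fin M → Lp ℂ p μ) (Y : Fin M → Set X), IsDisjointSystem e Y := by
  have hrank : (M : Cardinal) ≤ Module.rank ℂ (Lp ℂ p μ) :=
    Cardinal.natCast_le_aleph0.trans (not_lt.1 fun h => hL (Module.rank_lt_aleph0_iff.1 h))
  obtain ⟨ξ, hξ⟩ := exists_linearIndependent_of_le_rank hrank
  obtain ⟨ε, hε, hball⟩ := Metric.isOpen_iff.1
    (isOpen_setOfPred_linearIndependent (𝕜 := ℂ) (ι := Fin M) (E := Lp ℂ p μ)) ξ hξ
  obtain ⟨m, e, Y, hsys, ξ', hspan, hξ'⟩ := exists_disjointSystem_approx hp ξ hε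
  have hind : LinearIndependent ℂ ξ' := by
    refine hball ?_
    rw [Metric.mem_ball', dist_pi_lt_iff hε]
    intro i
    rw [dist_eq_norm]
    exact hξ' i
  have hM : M ≤ m := by
    have h1 : LinearIndependent ℂ (fun i => (⟨ξ' i, hspan i⟩ : Submodule.span ℂ (Set.range e))) :=
      LinearIndependent.of_comp (Submodule.subtype _) hind
    have := FiniteDimensional.span_of_finite ℂ (Set.finite_range e)
    have h2 := h1.fintype_card_le_finrank
    have h3 := finrank_range_le_card (R := ℂ) e
    rw [Fintype.card_fin] at h2 h3
    exact h2.trans h3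
  exact ⟨_, _, hsys.comp_injective (Fin.castLE_injective hM)⟩

end Systems

/-! ### Operators on `ℓ_p`-sums of copies of `L_p(X)` -/

section RowOperators

variable {X : Type*} [MeasurableSpace X] {p : ℝ≥0∞} [Fact (1 ≤ p)] {μ : Measure X}
  {G : Type*} [AddCommGroup G] [Module ℂ G] {N : Lp ℂ p μ ⊗[ℂ] G → ℝ}

/-- For a projection `P` onto the span of a disjoint system, copies of this span which are
supported by disjoint sets replace the copies of `L_p(X)` in an `ℓ_p`-sum. -/
theorem IsPConvex.norm_sum_act_projection_le (hp : p ≠ ∞) (hN : IsLNorm N) (hc : IsPConvex N)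
    {n m : ℕ} {e : Fin m → Lp ℂ p μ}
    {φ : Fin m → Lp ℂ p μ →L[ℂ] ℂ}
    (hφ : ∀ f, ∑ i, ‖φ i f‖ ^ p.toReal ≤ ‖f‖ ^ p.toReal)
    (he : ∀ c : Fin m → ℂ, ‖∑ i, c i • e i‖ ^ p.toReal = ∑ i, ‖c i‖ ^ p.toReal)
    {e' : Fin n × Fin m → Lp ℂ p μ} {Y' : Fin n × Fin m → Set X} (h' : IsDisjointSystem e' Y')
    (b : Fin n → Lp ℂ p μ →L[ℂ] Lp ℂ p μ) {B : ℝ} (hB : 0 ≤ B)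
    (hb : ∀ ζ : Fin n → Lp ℂ p μ,
      ‖∑ k, b k (ζ k)‖ ≤ B * (∑ k, ‖ζ k‖ ^ p.toReal) ^ (1 / p.toReal))
    (z : Fin n → Lp ℂ p μ ⊗[ℂ] G) :
    N (∑ k, act (b k) (act (∑ i, (φ i).smulRight (e i)) (z k))) ≤
      B * (∑ k, N (z k) ^ p.toReal) ^ (1 / p.toReal) := by
  have hq := toReal_pos' hp
  obtain ⟨φ', hφ', hφe'⟩ := h'.exists_biorthogonal
  -- `S k` moves the span of `e` to the `k`-th copy, `T k` moves it back
  let S : Fin n → Lp ℂ p μ →L[ℂ] Lp ℂ p μ := fun k => ∑ i, (φ i).smulRight (e' (k, i))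
  let T : Fin n → Lp ℂ p μ →L[ℂ] Lp ℂ p μ := fun k => ∑ i, (φ' (k, i)).smulRight (e i)
  have hS : ∀ k f, S k f = ∑ i, φ i f • e' (k, i) := fun k f => by
    simp [S]
  have hT : ∀ k f, T k f = ∑ i, φ' (k, i) f • e i := fun k f => by
    simp [T]
  have hTS : ∀ k l f, T k (S l f) = if k = l then (∑ i, (φ i).smulRight (e i)) f else 0 := by
    intro k l f
    rw [hT, hS]
    simp only [map_sum, map_smul, hφe', Prod.mk.injEq, smul_eq_mul]
    by_cases hkl : k = l
    · simp [hkl]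
    · simp [hkl]
  have hbS : ∀ k, (∑ l, b l ∘L T l) ∘L S k = b k ∘L ∑ i, (φ i).smulRight (e i) := by
    intro k
    refine ContinuousLinearMap.ext fun f => ?_
    rw [ContinuousLinearMap.comp_apply, sum_apply, Finset.sum_eq_single k]
    · rw [ContinuousLinearMap.comp_apply, hTS, if_pos rfl, ContinuousLinearMap.comp_apply]
    · intro l _ hl
      rw [ContinuousLinearMap.comp_apply, hTS, if_neg hl, map_zero]
    · exact fun h => (h (Finset.mem_univ k)).elim
  have hSnorm : ∀ k, ‖S k‖ ≤ 1 := by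
    intro k
    refine ContinuousLinearMap.opNorm_le_bound _ zero_le_one fun f => ?_
    rw [one_mul, ← Real.rpow_le_rpow_iff (norm_nonneg _) (norm_nonneg _) hq, hS]
    have h1 := (h'.comp_injective (Prod.mk_right_injective k)).norm_sum_smul_rpow hp
      (fun i => φ i f)
    exact h1.le.trans (hφ f)
  have hnorm : ‖∑ l, b l ∘L T l‖ ≤ B := by
    refine ContinuousLinearMap.opNorm_le_bound _ hB fun f => ?_
    rw [sum_apply]
    refine (hb fun l => T l f).trans (mul_le_mul_of_nonneg_left ?_ hB)
    rw [← rpow_rpow_one_div (norm_nonneg f) hq]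
    refine Real.rpow_le_rpow (Finset.sum_nonneg fun _ _ => Real.rpow_nonneg (norm_nonneg _) _) ?_
      (by simp)
    calc ∑ l, ‖T l f‖ ^ p.toReal = ∑ l, ∑ i, ‖φ' (l, i) f‖ ^ p.toReal := by
          refine Finset.sum_congr rfl fun l _ => ?_
          rw [hT, he]
      _ = ∑ li, ‖φ' li f‖ ^ p.toReal := 
          (Fintype.sum_prod_type fun li => ‖φ' li f‖ ^ p.toReal).symm
      _ ≤ ‖f‖ ^ p.toReal := h'.sum_norm_biorthogonal_rpow_le hp hφ' f
  have hsum : ∑ k, act (b k) (act (∑ i, (φ i).smulRight (e i)) (z k)) =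
      act (∑ l, b l ∘L T l) (∑ k, act (S k) (z k)) := by
    rw [map_sum]
    refine Finset.sum_congr rfl fun k _ => ?_
    rw [act_act, act_act, hbS]
  have hconv := hc.sum_rpow_le hp hN.isNorm Finset.univ (fun k => ⋃ i, Y' (k, i))
    (fun k => MeasurableSet.iUnion fun i => h'.measurableSet (k, i))
    (fun k l hkl => properProj_eq_zero_of_disjoint _ _ (by
      simp only [Set.disjoint_iUnion_left, Set.disjoint_iUnion_right]
      exact fun i j => h'.disjoint fun h => hkl (congrArg Prod.fst h)))
    (fun k => act (S k) (z k)) (fun k => by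
      rw [act_act]
      congr 2
      refine ContinuousLinearMap.ext fun f => ?_
      rw [ContinuousLinearMap.comp_apply, hS, map_sum]
      refine Finset.sum_congr rfl fun i _ => ?_
      rw [map_smul]
      congr 1
      have h1 := h'.properProj_eq (k, i)
      rw [properProj_eq_self_iff] at h1 ⊢
      filter_upwards [h1] with x hx hx'
      exact hx fun hx'' => hx' (Set.mem_iUnion.2 ⟨i, hx''⟩))
  have h0 : 0 ≤ ∑ k, N (z k) ^ p.toReal :=
    Finset.sum_nonneg fun _ _ => Real.rpow_nonneg (hN.isNorm.nonneg _) _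
  have hle : N (∑ k, act (S k) (z k)) ≤ (∑ k, N (z k) ^ p.toReal) ^ (1 / p.toReal) := by
    rw [← Real.rpow_le_rpow_iff (hN.isNorm.nonneg _) (Real.rpow_nonneg h0 _) hq,
      rpow_one_div_rpow h0 hq]
    refine hconv.trans (Finset.sum_le_sum fun k _ => ?_)
    refine Real.rpow_le_rpow (hN.isNorm.nonneg _) ?_ hq.le
    exact (hN.act_le _ _).trans (mul_le_of_le_one_left (hN.isNorm.nonneg _) (hSnorm k))
  rw [hsum]
  exact (hN.act_le _ _).trans (mul_le_mul hnorm hle (hN.isNorm.nonneg _) hB)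

/-- If `(b_1, …, b_n)` is an operator of norm `B` from the `ℓ_p`-sum of `n` copies of `L_p(X)` to
`L_p(X)`, then its amplification on a `p`-convex `L`-space has norm at most `B`. The space `L_p(X)`
need not be isometric to that sum, but finite-dimensional pieces of the summands fit into it as
disjoint copies. -/
theorem IsPConvex.norm_sum_act_le (hp : p ≠ ∞) (hL : ¬ FiniteDimensional ℂ (Lp ℂ p μ))
    (hN : IsLNorm N) (hc : IsPConvex N) {n : ℕ} (b : Fin n → Lp ℂ p μ →L[ℂ] Lp ℂ p μ) {B : ℝ}
    (hB : 0 ≤ B) (hb : ∀ ζ : Fin n → Lp ℂ p μ,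
      ‖∑ k, b k (ζ k)‖ ≤ B * (∑ k, ‖ζ k‖ ^ p.toReal) ^ (1 / p.toReal))
    (z : Fin n → Lp ℂ p μ ⊗[ℂ] G) :
    N (∑ k, act (b k) (z k)) ≤ B * (∑ k, N (z k) ^ p.toReal) ^ (1 / p.toReal) := by
  have hq := toReal_pos' hp
  obtain ⟨e₀, he₀⟩ := exists_norm_eq_one_of_not_finiteDimensional hL
  choose d ξ g hz using fun k => TensorProduct.exists_sum_tmul_eq (z k)
  set K : ℝ := ∑ k, ‖b k‖ * ∑ i, N (e₀ ⊗ₜ g k i) with hK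
  have hK0 : 0 ≤ K := Finset.sum_nonneg fun k _ =>
    mul_nonneg (norm_nonneg _) (Finset.sum_nonneg fun i _ => hN.isNorm.nonneg _)
  suffices h : ∀ ε : ℝ, 0 < ε → N (∑ k, act (b k) (z k)) ≤
      B * (∑ k, N (z k) ^ p.toReal) ^ (1 / p.toReal) + 2 * ε * K by
    refine le_of_forall_pos_le_add fun δ hδ => ?_
    refine (h (δ / (2 * (K + 1))) (by positivity)).trans (add_le_add_right ?_ _)
    have h1 : 2 * (δ / (2 * (K + 1))) * K = δ * (K / (K + 1)) := by
      field_simp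
    rw [h1]
    exact mul_le_of_le_one_right hδ.le ((div_le_one (by positivity)).2 (by linarith))
  intro ε hε
  obtain ⟨m, e, Y, hsys, ξ', hspan, hξ'⟩ := exists_disjointSystem_approx hp
    (fun ki : Σ k, Fin (d k) => ξ ki.1 ki.2) hε
  obtain ⟨e'', Y'', hsys''⟩ := exists_disjointSystem hp hL (n * m)
  have hsys' := hsys''.comp_injective (finProdFinEquiv (m := n) (n := m)).injective
  obtain ⟨φ, hφ, hφe⟩ := hsys.exists_biorthogonal
  set P : Lp ℂ p μ →L[ℂ] Lp ℂ p μ := ∑ i, (φ i).smulRight (e i) with hP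
  have hPapply : ∀ f, P f = ∑ i, φ i f • e i := fun f => by
    simp [hP]
  have hPnorm : ∀ f, ‖P f‖ ≤ ‖f‖ := by
    intro f
    rw [← Real.rpow_le_rpow_iff (norm_nonneg _) (norm_nonneg _) hq, hPapply,
      hsys.norm_sum_smul_rpow hp]
    exact hsys.sum_norm_biorthogonal_rpow_le hp hφ f
  have hPspan : ∀ f ∈ Submodule.span ℂ (Set.range e), P f = f := by
    intro f hf
    induction hf using Submodule.span_induction with
    | mem x hx =>
      obtain ⟨j, rfl⟩ := hx
      rw [hPapply]
      simp [hφe]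
    | zero => exact map_zero P
    | add x y _ _ hx hy => rw [map_add, hx, hy]
    | smul c x _ hx => rw [map_smul, hx]
  have happrox : ∀ k i, ‖ξ k i - P (ξ k i)‖ ≤ 2 * ε := by
    intro k i
    have h1 := hξ' ⟨k, i⟩
    have h2 : ξ k i - P (ξ k i) = (ξ k i - ξ' ⟨k, i⟩) - P (ξ k i - ξ' ⟨k, i⟩) := by
      rw [map_sub, hPspan _ (hspan ⟨k, i⟩)]
      abel
    rw [h2]
    refine (norm_sub_le _ _).trans ?_
    have h3 := hPnorm (ξ k i - ξ' ⟨k, i⟩)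
    dsimp only at h1
    linarith
  have hdiff : ∀ k, N (act (b k) (z k - act P (z k))) ≤
      2 * ε * (‖b k‖ * ∑ i, N (e₀ ⊗ₜ g k i)) := by
    intro k
    have h1 : z k - act P (z k) = ∑ i, (ξ k i - P (ξ k i)) ⊗ₜ[ℂ] g k i := by
      conv_lhs => rw [hz k]
      rw [map_sum, ← Finset.sum_sub_distrib]
      exact Finset.sum_congr rfl fun i _ => (TensorProduct.sub_tmul _ _ _).symm
    calc N (act (b k) (z k - act P (z k))) ≤ ‖b k‖ * N (z k - act P (z k)) := hN.act_le _ _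
      _ ≤ ‖b k‖ * ∑ i, 2 * ε * N (e₀ ⊗ₜ g k i) := by
        refine mul_le_mul_of_nonneg_left ?_ (norm_nonneg _)
        rw [h1]
        refine (hN.isNorm.sum_le _ _).trans (Finset.sum_le_sum fun i _ => ?_)
        rw [hN.isNearLNorm.tmul_eq he₀]
        exact mul_le_mul_of_nonneg_right (happrox k i) (hN.isNorm.nonneg _)
      _ = 2 * ε * (‖b k‖ * ∑ i, N (e₀ ⊗ₜ g k i)) := by
        rw [← Finset.mul_sum]
        ring
  have hsplit : ∑ k, act (b k) (z k) =
      ∑ k, act (b k) (act P (z k)) + ∑ k, act (b k) (z k - act P (z k)) := by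
    rw [← Finset.sum_add_distrib]
    refine Finset.sum_congr rfl fun k _ => ?_
    rw [← map_add]
    congr 1
    abel
  rw [hsplit]
  refine (hN.isNorm.add_le _ _).trans (add_le_add ?_ ?_)
  · exact hc.norm_sum_act_projection_le hp hN (hsys.sum_norm_biorthogonal_rpow_le hp hφ)
      (hsys.norm_sum_smul_rpow hp) hsys' b hB hb z
  · refine (hN.isNorm.sum_le _ _).trans ?_
    rw [hK, Finset.mul_sum]
    exact Finset.sum_le_sum fun k _ => hdiff k

end RowOperators

/-! ### The pulled back norm and its universal property -/

section PulledBack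

variable {X : Type*} [MeasurableSpace X] {p : ℝ≥0∞} [Fact (1 ≤ p)] {μ : Measure X}
  {E F G : Type*} [AddCommGroup E] [Module ℂ E] [AddCommGroup F] [Module ℂ F]
  [AddCommGroup G] [Module ℂ G]
  {dia : Lp ℂ p μ →L[ℂ] Lp ℂ p μ →L[ℂ] Lp ℂ p μ}
  {NE : Lp ℂ p μ ⊗[ℂ] E → ℝ} {NF : Lp ℂ p μ ⊗[ℂ] F → ℝ} {NG : Lp ℂ p μ ⊗[ℂ] G → ℝ}

theorem Q_J (f : Lp ℂ p μ) : Q p μ (J p μ f) = f := component_zero_J f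

theorem norm_diaBar (dia : Lp ℂ p μ →L[ℂ] Lp ℂ p μ →L[ℂ] Lp ℂ p μ) : ‖diaBar dia‖ = ‖dia‖ := by
  refine le_antisymm ?_ ?_
  · refine ContinuousLinearMap.opNorm_le_bound₂ _ (norm_nonneg dia) fun ξ η => ?_
    rw [diaBar_apply, norm_J]
    have hQ : ∀ ζ, ‖Q p μ ζ‖ ≤ ‖ζ‖ := fun ζ =>
      ((Q p μ).le_of_opNorm_le norm_Q_le ζ).trans (one_mul _).le
    refine (dia.le_opNorm₂ _ _).trans ?_
    gcongr
    · exact hQ ξ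
    · exact hQ η
  · refine ContinuousLinearMap.opNorm_le_bound₂ _ (norm_nonneg (diaBar dia)) fun ξ η => ?_
    have h := (diaBar dia).le_opNorm₂ (J p μ ξ) (J p μ η)
    rwa [diaBar_apply, Q_J, Q_J, norm_J, norm_J, norm_J] at h

theorem ampBilin_diaBar (ρ : E →ₗ[ℂ] F →ₗ[ℂ] G) (u : Lp ℂ p (copies μ) ⊗[ℂ] E)
    (v : Lp ℂ p (copies μ) ⊗[ℂ] F) :
    ampBilin (diaBar dia) ρ u v =
      act (J p μ) (ampBilin dia ρ (act (Q p μ) u) (act (Q p μ) v)) := by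
  induction u with
  | zero => simp
  | add u u' hu hu' => simp only [map_add, LinearMap.add_apply, hu, hu']
  | tmul ξ x =>
    induction v with
    | zero => simp
    | add v v' hv hv' => simp only [map_add, hv, hv']
    | tmul η y => rw [ampBilin_tmul, act_tmul, act_tmul, ampBilin_tmul, act_tmul, diaBar_apply]

theorem act_Q_act_J (u : Lp ℂ p μ ⊗[ℂ] E) : act (Q p μ) (act (J p μ) u) = u :=
  act_component_zero_act_J u

theorem norm_sum_comp_isometry_le (hp : p ≠ ∞) {n : ℕ}
    {I : Fin n → Lp ℂ p (copies μ) →ₗᵢ[ℂ] Lp ℂ p (copies μ)} (hI : ∀ k, IsProperIsometry (I k))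
    (hd : ∀ j k, j ≠ k → Set.range (I j) ∩ Set.range (I k) = {0})
    (a : Lp ℂ p (copies μ) →L[ℂ] Lp ℂ p (copies μ)) (ζ : Fin n → Lp ℂ p μ) :
    ‖∑ k, (Q p μ ∘L a ∘L (I k).toContinuousLinearMap ∘L J p μ) (ζ k)‖ ≤
      ‖a‖ * (∑ k, ‖ζ k‖ ^ p.toReal) ^ (1 / p.toReal) := by
  choose Y hY hr using hI
  have hfix : ∀ k f, properProj p _ (Y k) (hY k) (I k f) = I k f := fun k f => by
    rw [← mem_range_properProj_iff, ← hr k]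
    exact Set.mem_range_self f
  have h1 : ‖∑ k, I k (J p μ (ζ k))‖ ^ p.toReal = ∑ k, ‖ζ k‖ ^ p.toReal := by
    rw [norm_sum_rpow_of_disjointSupp hp]
    · simp_rw [LinearIsometry.norm_map, norm_J]
    · intro j _ k _ hjk
      refine disjointSupp_of_properProj (hY j) (hY k)
        (properProj_comp_eq_zero_of_range_inter (hY j) (hY k) ?_) (hfix j _) (hfix k _)
      rw [← hr j, ← hr k, hd j k hjk]
  have h2 : ∑ k, (Q p μ ∘L a ∘L (I k).toContinuousLinearMap ∘L J p μ) (ζ k) =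
      Q p μ (a (∑ k, I k (J p μ (ζ k)))) := by
    rw [map_sum, map_sum]
    rfl
  rw [h2, ← h1, rpow_rpow_one_div (norm_nonneg _) (toReal_pos' hp)]
  calc _ ≤ 1 * ‖a (∑ k, I k (J p μ (ζ k)))‖ := (Q p μ).le_of_opNorm_le norm_Q_le _
    _ = ‖a (∑ k, I k (J p μ (ζ k)))‖ := one_mul _
    _ ≤ _ := a.le_opNorm _

/-- A representation of `J · U` gives `U = ∑ b_k · (u_k ⋄ v_k)` with `b_k = Q a I_k J`, and the row
`(b_1, …, b_n)` has norm at most `‖a‖` on the `ℓ_p`-sum. -/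
theorem norm_amp_lift_le_of_mem_reprValues_J (hp : p ≠ ∞)
    (hL : ¬ FiniteDimensional ℂ (Lp ℂ p μ)) (hE : IsNearLNorm NE) (hF : IsNearLNorm NF)
    (hN : IsLNorm NG) (hc : IsPConvex NG) {ρ : E →ₗ[ℂ] F →ₗ[ℂ] G} {C : ℝ} (hC : 0 ≤ C)
    (hρ : ∀ u v, NG (ampBilin dia ρ u v) ≤ C * (NE u * NF v))
    {U : Lp ℂ p μ ⊗[ℂ] (E ⊗[ℂ] F)} {r : ℝ}
    (hr : r ∈ reprValues (diaBar dia) (stdExt NE) (stdExt NF) (act (J p μ) U)) :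
    NG (amp (Lp ℂ p μ) (TensorProduct.lift ρ) U) ≤ C * r := by
  obtain ⟨n, a, I, u, v, hI, hd, hU, rfl⟩ := hr
  have hq := toReal_pos' hp
  obtain ⟨e, he⟩ := exists_norm_eq_one_of_not_finiteDimensional hL
  have hR : ∀ x y, TensorProduct.lift ρ (TensorProduct.mk ℂ E F x y) = ρ x y := fun x y => rfl
  set z := fun k => ampBilin dia ρ (act (Q p μ) (u k)) (act (Q p μ) (v k)) with hz
  have hrep : amp (Lp ℂ p μ) (TensorProduct.lift ρ) U =
      ∑ k, act (Q p μ ∘L a ∘L (I k).toContinuousLinearMap ∘L J p μ) (z k) := by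
    rw [← act_Q_act_J U, hU]
    simp only [map_sum, amp_act, amp_ampBilin _ hR, ampBilin_diaBar, act_act]
    simp only [hz, ← act_act]
  have hsE := stdExt_nonneg (N := NE) hE.isNorm.nonneg
  have hsF := stdExt_nonneg (N := NF) hF.isNorm.nonneg
  have h0 : 0 ≤ ∑ k, stdExt NE (u k) ^ p.toReal * stdExt NF (v k) ^ p.toReal :=
    Finset.sum_nonneg fun k _ =>
      mul_nonneg (Real.rpow_nonneg (hsE _) _) (Real.rpow_nonneg (hsF _) _)
  have hzle : ∀ k, NG (z k) ^ p.toReal ≤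
      C ^ p.toReal * (stdExt NE (u k) ^ p.toReal * stdExt NF (v k) ^ p.toReal) := by
    intro k
    rw [← Real.mul_rpow (hsE _) (hsF _), ← Real.mul_rpow hC (mul_nonneg (hsE _) (hsF _))]
    refine Real.rpow_le_rpow (hN.isNorm.nonneg _) ((hρ _ _).trans ?_) hq.le
    refine mul_le_mul_of_nonneg_left ?_ hC
    exact mul_le_mul (le_stdExt_component hp he hE 0 _) (le_stdExt_component hp he hF 0 _)
      (hF.isNorm.nonneg _) (hsE _)
  have hsum : (∑ k, NG (z k) ^ p.toReal) ^ (1 / p.toReal) ≤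
      C * (∑ k, stdExt NE (u k) ^ p.toReal * stdExt NF (v k) ^ p.toReal) ^ (1 / p.toReal) := by
    rw [← rpow_rpow_one_div hC hq, ← Real.mul_rpow (Real.rpow_nonneg hC _) h0, Finset.mul_sum]
    exact Real.rpow_le_rpow
      (Finset.sum_nonneg fun k _ => Real.rpow_nonneg (hN.isNorm.nonneg _) _)
      (Finset.sum_le_sum fun k _ => hzle k) (by simp)
  rw [hrep]
  refine (hc.norm_sum_act_le hp hL hN _ (norm_nonneg a)
    (norm_sum_comp_isometry_le hp hI hd a) z).trans ?_
  refine (mul_le_mul_of_nonneg_left hsum (norm_nonneg a)).trans (le_of_eq ?_)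
  ring

theorem component_properProj {Y : Set X} (hY : MeasurableSet Y) (n : ℕ)
    (g : Lp ℂ p (copies μ)) :
    component p μ n (properProj p (copies μ) (Prod.snd ⁻¹' Y) (measurable_snd hY) g) =
      properProj p μ Y hY (component p μ n g) := by
  rw [Lp.ext_iff]
  filter_upwards [coeFn_component n
    (properProj p (copies μ) (Prod.snd ⁻¹' Y) (measurable_snd hY) g),
    (quasi_copies μ n).ae (coeFn_properProj (measurable_snd hY) g),
    coeFn_properProj hY (component p μ n g), coeFn_component n g] with x h1 h2 h3 h4
  rw [h1, h2, h3]
  by_cases hx : x ∈ Y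
  · rw [Set.indicator_of_mem hx, h4, Set.indicator_of_mem (show (n, x) ∈ Prod.snd ⁻¹' Y from hx)]
  · rw [Set.indicator_of_notMem hx,
      Set.indicator_of_notMem (show (n, x) ∉ Prod.snd ⁻¹' Y from hx)]

theorem isLNorm_pulledBackNorm
    (h : IsLNorm (pTensorNorm (diaBar dia) (stdExt NE) (stdExt NF))) :
    IsLNorm (pulledBackNorm dia NE NF) where
  isNorm :=
    { nonneg := fun U => h.isNorm.nonneg _
      add_le := fun U V => by
        rw [pulledBackNorm, map_add]
        exact h.isNorm.add_le _ _
      smul := fun c U => by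
        rw [pulledBackNorm, map_smul]
        exact h.isNorm.smul _ _
      eq_zero := fun U hU => by
        rw [← act_Q_act_J U, h.isNorm.eq_zero _ hU, map_zero] }
  act_le a U := by
    have h1 : act (J p μ) (act a U) = act (J p μ ∘L a ∘L Q p μ) (act (J p μ) U) := by
      rw [act_act, act_act]
      congr 2
      refine ContinuousLinearMap.ext fun f => ?_
      simp only [ContinuousLinearMap.comp_apply, Q_J]
    have h2 : ‖J p μ ∘L a ∘L Q p μ‖ ≤ ‖a‖ := by
      refine ContinuousLinearMap.opNorm_le_bound _ (norm_nonneg a) fun f => ?_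
      change ‖J p μ (a (Q p μ f))‖ ≤ _
      rw [norm_J]
      refine (a.le_opNorm _).trans (mul_le_mul_of_nonneg_left ?_ (norm_nonneg a))
      exact ((Q p μ).le_of_opNorm_le norm_Q_le f).trans (one_mul _).le
    rw [pulledBackNorm, h1]
    exact (h.act_le _ _).trans (mul_le_mul_of_nonneg_right h2 (h.isNorm.nonneg _))

theorem isPConvex_pulledBackNorm (hp : p ≠ ∞)
    (h : IsPConvex (pTensorNorm (diaBar dia) (stdExt NE) (stdExt NF))) :
    IsPConvex (pulledBackNorm dia NE NF) := by
  intro Y Z hY hZ hYZ hZY U V hU hV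
  have hcomp : ∀ (Y Z : Set X) (hY : MeasurableSet Y) (hZ : MeasurableSet Z),
      properProj p μ Y hY ∘L properProj p μ Z hZ = 0 →
      properProj p (copies μ) (Prod.snd ⁻¹' Y) (measurable_snd hY) ∘L
        properProj p (copies μ) (Prod.snd ⁻¹' Z) (measurable_snd hZ) = 0 := by
    intro Y Z hY hZ h0
    refine ContinuousLinearMap.ext fun g => eq_zero_of_component_eq_zero hp fun n => ?_
    rw [ContinuousLinearMap.comp_apply, component_properProj hY, component_properProj hZ,
      ← ContinuousLinearMap.comp_apply, h0]
    rfl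
  have hfix : ∀ (Y : Set X) (hY : MeasurableSet Y) (W : Lp ℂ p μ ⊗[ℂ] (E ⊗[ℂ] F)),
      act (properProj p μ Y hY) W = W →
      act (properProj p (copies μ) (Prod.snd ⁻¹' Y) (measurable_snd hY)) (act (J p μ) W) =
        act (J p μ) W := by
    intro Y hY W hW
    conv_rhs => rw [← hW]
    rw [act_act, act_act]
    congr 2
    exact ContinuousLinearMap.ext fun f => (J_properProj hY f).symm
  rw [pulledBackNorm, map_add]
  exact h _ _ _ _ (hcomp Y Z hY hZ hYZ) (hcomp Z Y hZ hY hZY) _ _ (hfix Y hY U hU) (hfix Z hZ V hV)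

theorem isPConvexTensorProduct_pTensorNorm
    {dia : Lp ℂ p (copies μ) →L[ℂ] Lp ℂ p (copies μ) →L[ℂ] Lp ℂ p (copies μ)}
    {E : Type uE} {F : Type uF} [AddCommGroup E] [Module ℂ E] [AddCommGroup F] [Module ℂ F]
    {NE : Lp ℂ p (copies μ) ⊗[ℂ] E → ℝ} {NF : Lp ℂ p (copies μ) ⊗[ℂ] F → ℝ}
    (hp : p ≠ ∞) (hdia : dia ≠ 0) {e : Lp ℂ p (copies μ)} (he : ‖e‖ = 1)
    (hE : IsNearLNorm NE) (hF : IsNearLNorm NF) :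
    IsPConvexTensorProduct.{_, uE, uF, max uE uF, w} dia NE NF (pTensorNorm dia NE NF)
      (TensorProduct.mk ℂ E F) where
  isLNorm := isLNorm_pTensorNorm hp hdia he hE hF
  isPConvex := isPConvex_pTensorNorm hp hdia hE.isNorm hF.isNorm
  contractive := pTensorNorm_ampBilin_le hp hE.isNorm hF.isNorm
  universal _ _ _ _ hN hc _ hρ :=
    exists_linearization hE.isNorm.nonneg hF.isNorm.nonneg
      (pTensorNorm_ampBilin_le hp hE.isNorm hF.isNorm)
      (fun _ hC hbd U => le_mul_pTensorNorm (reprValues_nonempty hp hdia U) hC fun _ hr =>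
        norm_amp_lift_le_of_mem_reprValues hp hE.isNorm hF.isNorm hN hc hC hbd hr) hρ

end PulledBack

end LSpace

theorem mainTheorem1 {X : Type uX} [MeasurableSpace X] (μ : Measure X) [IsSeparable μ]
    (p : ℝ≥0∞) [Fact (1 ≤ p)] (hp : p ≠ ∞)
    (hL : ¬ FiniteDimensional ℂ (Lp ℂ p μ))
    (dia : Lp ℂ p μ →L[ℂ] Lp ℂ p μ →L[ℂ] Lp ℂ p μ) (hdia : ‖dia‖ = 1)
    {E : Type uE} [AddCommGroup E] [Module ℂ E] {F : Type uF} [AddCommGroup F] [Module ℂ F]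
    (NE : Lp ℂ p μ ⊗[ℂ] E → ℝ) (NF : Lp ℂ p μ ⊗[ℂ] F → ℝ)
    (hE : LSpace.IsNearLNorm NE) (hF : LSpace.IsNearLNorm NF) :
    (LSpace.IsNearLNorm (LSpace.stdExt NE) ∧ LSpace.IsNearLNorm (LSpace.stdExt NF) ∧
      ‖LSpace.diaBar dia‖ = 1 ∧
      LSpace.IsPConvexTensorProduct.{uX, uE, uF, max uE uF, w} (LSpace.diaBar dia)
        (LSpace.stdExt NE) (LSpace.stdExt NF)
        (LSpace.pTensorNorm (LSpace.diaBar dia) (LSpace.stdExt NE) (LSpace.stdExt NF))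
        (TensorProduct.mk ℂ E F)) ∧
    LSpace.IsPConvexTensorProduct.{uX, uE, uF, max uE uF, w} dia NE NF
      (LSpace.pulledBackNorm dia NE NF) (TensorProduct.mk ℂ E F) := by
  obtain ⟨e, he⟩ := LSpace.exists_norm_eq_one_of_not_finiteDimensional hL
  have he' : ‖LSpace.J p μ e‖ = 1 := by rw [LSpace.norm_J, he]
  have hsE := LSpace.isNearLNorm_stdExt hp he hE
  have hsF := LSpace.isNearLNorm_stdExt hp he hF
  have hbar : ‖LSpace.diaBar dia‖ = 1 := (LSpace.norm_diaBar dia).trans hdia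
  have hbar0 : LSpace.diaBar dia ≠ 0 := by
    intro h
    rw [h, ContinuousLinearMap.opNorm_zero] at hbar
    exact zero_ne_one hbar
  have hcontr : ∀ u v, LSpace.pulledBackNorm dia NE NF
      (LSpace.ampBilin dia (TensorProduct.mk ℂ E F) u v) ≤ NE u * NF v := by
    intro u v
    have h := LSpace.pTensorNorm_ampBilin_le (dia := LSpace.diaBar dia) hp hsE.isNorm hsF.isNorm
      (LSpace.act (LSpace.J p μ) u) (LSpace.act (LSpace.J p μ) v)
    rwa [LSpace.ampBilin_diaBar, LSpace.act_Q_act_J, LSpace.act_Q_act_J,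
      LSpace.stdExt_act_J hp hE.isNorm, LSpace.stdExt_act_J hp hF.isNorm] at h
  refine ⟨⟨hsE, hsF, hbar,
    LSpace.isPConvexTensorProduct_pTensorNorm hp hbar0 he' hsE hsF⟩, ?_⟩
  exact
    { isLNorm := LSpace.isLNorm_pulledBackNorm (LSpace.isLNorm_pTensorNorm hp hbar0 he' hsE hsF)
      isPConvex := LSpace.isPConvex_pulledBackNorm hp
        (LSpace.isPConvex_pTensorNorm hp hbar0 hsE.isNorm hsF.isNorm)
      contractive := hcontr
      universal := fun _ _ _ _ hN hc _ hρ =>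
        LSpace.exists_linearization hE.isNorm.nonneg hF.isNorm.nonneg hcontr
          (fun _ hC hbd _ => LSpace.le_mul_pTensorNorm (LSpace.reprValues_nonempty hp hbar0 _) hC
            fun _ hr => LSpace.norm_amp_lift_le_of_mem_reprValues_J hp hL hE hF hN hc hC hbd hr)
          hρ }
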